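/- Let $n\in\mathbb N_0$, $t>0$, and for $s>0$ let $d\mu_s(z)=(\pi s)^{-n}e^{-|z|^2/s}\,dV(z)$ on $\mathbb C^n$. For $1<p<\infty$ let $F_t^p$ be the Fock space of entire functions on $\mathbb C^n$ belonging to $L^p(\mathbb C^n,\mu_{2t/p})$, with the norm of that space (for $p=2$ a Hilbert space with the inner product of $L^2(\mu_t)$). For a bounded continuous function $f$ on $\mathbb C^n$ let $T_f^t$ be the Toeplitz operator on $F_t^p$, $$T_f^t g(z)=\int_{\mathbb C^n} e^{z\cdot\overline w/t}f(w)g(w)\,d\mu_t(w),$$ and for a bounded operator $A$ on $F_t^p$ let $$\widetilde A(z)=\int_{\mathbb C^n}(Ak_z^t)(w)\,\overline{k_z^t(w)}\,d\mu_t(w),\qquad k_z^t(w)=e^{w\cdot\overline z/t-|z|^2/(2t)},$$ be its Berezin transform. For a set $S$ of symbols let $\mathcal T^{p,t}_{lin}(S)$ be the closed linear span in $\mathcal L(F_t^p)$ of $\{T_f^t: f\in S\}$, let $\mathcal T^{p,t}(S)$ be the (not necessarily unital) closed subalgebra of $\mathcal L(F_t^p)$ generated by these operators, and for $p=2$ let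 $\mathcal T^{2,t}_*(S)$ be the (not necessarily unital) $C^*$-subalgebra of $\mathcal L(F_t^2)$ generated by them. Let $\mathcal D_0$ be a linear subspace of the space $\mathrm{BUC}(\mathbb C^n)$ of bounded uniformly continuous functions $\mathbb C^n\to\mathbb C$ that is closed in the supremum norm and invariant under translations, i.e. $f(\cdot-z)\in\mathcal D_0$ for all $f\in\mathcal D_0$, $z\in\mathbb C^n$. 1. For every $1<p<\infty$: $\mathcal T^{p,t}_{lin}(\mathcal D_0)=\mathcal T^{p,t}(\mathcal D_0)$ if and only if $$(T_{f_1}^t\cdots T_{f_k}^t)^{\sim}\in\mathcal D_0\quad\text{for all } k\ge 1 \text{ and all } f_1,\dots,f_k\in\mathcal D_0,\qquad(\ast)$$ where the operators act on $F_t^p$. 2. $\mathcal T^{2,t}_{lin}(\mathcal D_0)=\mathcal T^{2,t}_*(\mathcal D_0)$ if and only if $(\ast)$ holds with operators acting on $F_t^2$ and $\mathcal D_0$ is closed under complex conjugation. -/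

import Mathlib

open MeasureTheory Complex
open scoped ENNReal ComplexConjugate BoundedContinuousFunction

noncomputable section

namespace Fock

variable {n : ℕ} {t : ℝ} {p : ℝ≥0∞}

/-- The square `|z|²` of the Euclidean norm on `ℂⁿ`. -/
def sqNorm (z : Fin n → ℂ) : ℝ := ∑ i, ‖z i‖ ^ 2

/-- The sesquilinear product `z · w̄ = ∑ zᵢ w̄ᵢ` on `ℂⁿ`. -/
def herm (z w : Fin n → ℂ) : ℂ := ∑ i, z i * conj (w i)

/-- The Gaussian measure `dμ_t(z) = (πt)⁻ⁿ exp(-|z|²/t) dV(z)` on `ℂⁿ`. -/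
def gauss (n : ℕ) (t : ℝ) : Measure (Fin n → ℂ) :=
  volume.withDensity fun z =>
    ENNReal.ofReal (((Real.pi * t) ^ n)⁻¹ * Real.exp (-sqNorm z / t))

/-- The integral operator `P_t h(z) = ∫ exp(z · w̄ / t) h(w) dμ_t(w)`. -/
def bargmann (t : ℝ) (h : (Fin n → ℂ) → ℂ) (z : Fin n → ℂ) : ℂ :=
  ∫ w, cexp (herm z w / t) * h w ∂(gauss n t)

/-- Auxiliary `ℓ¹`-size `∑ |wᵢ|`. -/
def oneNorm (w : Fin n → ℂ) : ℝ := ∑ i, ‖w i‖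

lemma continuous_sqNorm : Continuous (sqNorm (n := n)) := by
  unfold sqNorm; fun_prop

lemma continuous_oneNorm : Continuous (oneNorm (n := n)) := by
  unfold oneNorm; fun_prop

lemma continuous_herm_right (z : Fin n → ℂ) : Continuous (herm z) := by
  unfold herm; fun_prop

lemma continuous_herm_left (w : Fin n → ℂ) : Continuous (fun z => herm z w) := by
  unfold herm; fun_prop

lemma sqNorm_nonneg (z : Fin n → ℂ) : 0 ≤ sqNorm z :=
  Finset.sum_nonneg fun _ _ => by positivity

lemma oneNorm_nonneg (z : Fin n → ℂ) : 0 ≤ oneNorm z :=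
  Finset.sum_nonneg fun _ _ => by positivity

lemma herm_conj (z w : Fin n → ℂ) : conj (herm z w) = herm w z := by
  simp [herm, map_sum, mul_comm]

lemma sqNorm_eq_herm (z : Fin n → ℂ) : (sqNorm z : ℂ) = herm z z := by
  simp [sqNorm, herm, Complex.mul_conj, Complex.normSq_eq_norm_sq]

lemma herm_add_left (z z' w : Fin n → ℂ) : herm (z + z') w = herm z w + herm z' w := by
  simp [herm, add_mul, Finset.sum_add_distrib]

lemma herm_add_right (z w w' : Fin n → ℂ) : herm z (w + w') = herm z w + herm z w' := by
  simp [herm, mul_add, Finset.sum_add_distrib]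

lemma sqNorm_add (z w : Fin n → ℂ) :
    sqNorm (z + w) = sqNorm z + sqNorm w + 2 * (herm z w).re := by
  have h := congrArg Complex.re (sqNorm_eq_herm (z + w))
  have h1 := congrArg Complex.re (sqNorm_eq_herm z)
  have h2 := congrArg Complex.re (sqNorm_eq_herm w)
  have h3 := congrArg Complex.re (herm_conj z w)
  simp only [herm_add_left, herm_add_right, Complex.add_re, Complex.ofReal_re,
    Complex.conj_re] at *
  linarith

lemma sqNorm_neg (z : Fin n → ℂ) : sqNorm (-z) = sqNorm z := by simp [sqNorm]

lemma sqNorm_sub (z w : Fin n → ℂ) :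
    sqNorm (z - w) = sqNorm z + sqNorm w - 2 * (herm z w).re := by
  have : herm z (-w) = - herm z w := by simp [herm]
  rw [sub_eq_add_neg, sqNorm_add, sqNorm_neg, this]; simp; ring

lemma norm_herm_le (z w : Fin n → ℂ) : ‖herm z w‖ ≤ ‖z‖ * oneNorm w := by
  unfold herm oneNorm
  rw [Finset.mul_sum]
  refine (norm_sum_le _ _).trans (Finset.sum_le_sum fun i _ => ?_)
  simpa using mul_le_mul_of_nonneg_right (norm_le_pi_norm z i) (norm_nonneg (w i))

lemma exp_oneNorm_le {b : ℝ} (hb : 0 < b) (M : ℝ) (w : Fin n → ℂ) :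
    Real.exp (M * oneNorm w - b * sqNorm w)
      ≤ Real.exp (n * (M ^ 2 / (2 * b))) * Real.exp (-(b / 2) * sqNorm w) := by
  rw [← Real.exp_add]
  refine Real.exp_le_exp.2 ?_
  have : ∑ i, (M * ‖w i‖) ≤ ∑ i : Fin n, (M ^ 2 / (2 * b) + b / 2 * ‖w i‖ ^ 2) := by
    refine Finset.sum_le_sum fun i _ => ?_
    have : M ^ 2 / (2 * b) + b / 2 * ‖w i‖ ^ 2 - M * ‖w i‖ = (M - b * ‖w i‖) ^ 2 / (2 * b) := by
      field_simp; ring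
    have h2 : 0 ≤ (M - b * ‖w i‖) ^ 2 / (2 * b) := by positivity
    linarith
  rw [Finset.sum_add_distrib, ← Finset.mul_sum, ← Finset.mul_sum] at this
  simp only [Finset.sum_const, Finset.card_univ, Fintype.card_fin, nsmul_eq_mul] at this
  unfold oneNorm sqNorm
  linarith

lemma exp_sqNorm_eq_prod (b : ℝ) (w : Fin n → ℂ) :
    Real.exp (-b * sqNorm w) = ∏ i, Real.exp (-b * ‖w i‖ ^ 2) := by
  rw [← Real.exp_sum, sqNorm, Finset.mul_sum]

lemma integrable_gauss_one {b : ℝ} (hb : 0 < b) :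
    Integrable fun z : ℂ => Real.exp (-b * ‖z‖ ^ 2) := by
  have := (GaussianFourier.integrable_cexp_neg_mul_sq_norm_add (V := ℂ) (b := b)
    (by simpa using hb) 0 0).norm
  refine this.congr (.of_forall fun z => ?_)
  simp only [Complex.norm_exp]
  congr 1
  simp [← Complex.ofReal_pow]

lemma integrable_exp_sqNorm {b : ℝ} (hb : 0 < b) :
    Integrable fun w : Fin n → ℂ => Real.exp (-b * sqNorm w) := by
  simp_rw [exp_sqNorm_eq_prod]
  exact Integrable.fintype_prod (f := fun (_ : Fin n) (z : ℂ) => Real.exp (-b * ‖z‖ ^ 2))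
    fun _ => integrable_gauss_one hb

lemma integral_exp_sqNorm {b : ℝ} (hb : 0 < b) :
    ∫ w : Fin n → ℂ, Real.exp (-b * sqNorm w) = (Real.pi / b) ^ n := by
  simp_rw [exp_sqNorm_eq_prod]
  rw [integral_fintype_prod_volume_eq_pow (fun z : ℂ => Real.exp (-b * ‖z‖ ^ 2)),
    GaussianFourier.integral_rexp_neg_mul_sq_norm hb]
  simp

/-- Integration against `μ_t` in terms of Lebesgue measure. -/
lemma integral_gauss (ht : 0 < t) (h : (Fin n → ℂ) → ℂ) :
    ∫ w, h w ∂(gauss n t)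
      = ∫ w, ((((Real.pi * t) ^ n)⁻¹ * Real.exp (-sqNorm w / t) : ℝ) : ℂ) * h w := by
  unfold gauss
  rw [integral_withDensity_eq_integral_toReal_smul]
  · refine integral_congr_ae (.of_forall fun w => ?_)
    simp only
    rw [ENNReal.toReal_ofReal (by positivity), Complex.real_smul]
  · have := continuous_sqNorm (n := n)
    exact Measurable.ennreal_ofReal (by fun_prop)
  · exact .of_forall fun w => ENNReal.ofReal_lt_top

lemma measurable_dens (t : ℝ) : Measurable fun z : Fin n → ℂ =>
    ENNReal.ofReal (((Real.pi * t) ^ n)⁻¹ * Real.exp (-sqNorm z / t)) := by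
  have := continuous_sqNorm (n := n)
  exact Measurable.ennreal_ofReal (by fun_prop)

lemma gauss_ac (t : ℝ) : gauss n t ≪ volume := withDensity_absolutelyContinuous _ _

lemma ac_gauss (ht : 0 < t) : (volume : Measure (Fin n → ℂ)) ≪ gauss n t := by
  refine withDensity_absolutelyContinuous' (measurable_dens t).aemeasurable
    (.of_forall fun z => ?_)
  have : 0 < ((Real.pi * t) ^ n)⁻¹ * Real.exp (-sqNorm z / t) := by positivity
  simpa using this

/-- The `L^p(μ_{2t/p})` norm is, up to a constant, the `L^p(dV)` norm of the weighted function. -/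
lemma lintegral_weight (ht : 0 < t) {q : ℝ} (hq : 1 ≤ q) (h : (Fin n → ℂ) → ℂ) :
    ∫⁻ z, ‖h z‖ₑ ^ q ∂(gauss n (2 * t / q))
      = ENNReal.ofReal ((Real.pi * (2 * t / q)) ^ n)⁻¹
        * ∫⁻ z, (‖h z‖ₑ * ENNReal.ofReal (Real.exp (-sqNorm z / (2 * t)))) ^ q := by
  unfold gauss
  rw [lintegral_withDensity_eq_lintegral_mul_non_measurable _ (measurable_dens _)
    (.of_forall fun w => ENNReal.ofReal_lt_top), ← lintegral_const_mul' _ _ ENNReal.ofReal_ne_top]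
  refine lintegral_congr fun z => ?_
  have hq0 : 0 < q := by linarith
  rw [Pi.mul_apply, ENNReal.ofReal_mul (by positivity), ENNReal.mul_rpow_of_nonneg _ _ hq0.le,
    ENNReal.ofReal_rpow_of_nonneg (by positivity) hq0.le, ← Real.exp_mul]
  rw [show -sqNorm z / (2 * t) * q = -sqNorm z / (2 * t / q) by field_simp]
  ring

/-- Young's inequality for the convolution of a kernel in `L¹` with a function in `L^q`. -/
lemma young {q : ℝ} (hq : 1 ≤ q) {K H : (Fin n → ℂ) → ℝ≥0∞} (hK : Measurable K)
    (hKfin : ∫⁻ w, K w ≠ ∞) (hH : AEMeasurable H) :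
    ∫⁻ z, (∫⁻ w, K (z - w) * H w) ^ q ≤ (∫⁻ w, K w) ^ q * ∫⁻ w, H w ^ q := by
  have hq0 : 0 < q := by linarith
  have hK1 : ∀ z, ∫⁻ w, K (z - w) = ∫⁻ w, K w := fun z => lintegral_sub_left_eq_self K z
  have hK2 : ∀ w, ∫⁻ z, K (z - w) = ∫⁻ w, K w := fun w => lintegral_sub_right_eq_self K w
  have key : ∀ z, (∫⁻ w, K (z - w) * H w) ^ q
      ≤ (∫⁻ w, K w) ^ (q - 1) * ∫⁻ w, K (z - w) * H w ^ q := by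
    intro z
    have hm : Measurable fun w => K (z - w) := hK.comp (by fun_prop)
    set ν : Measure (Fin n → ℂ) := volume.withDensity fun w => K (z - w) with hν
    have hac : ν ≪ volume := withDensity_absolutelyContinuous _ _
    have hfin : ∀ᵐ w : Fin n → ℂ, K (z - w) < ∞ :=
      ae_lt_top hm (by rw [hK1]; exact hKfin)
    have e1 : ∀ G : (Fin n → ℂ) → ℝ≥0∞, ∫⁻ w, G w ∂ν = ∫⁻ w, K (z - w) * G w := fun G => by
      rw [hν, lintegral_withDensity_eq_lintegral_mul_non_measurable _ hm hfin]; rfl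
    have e2 : ν Set.univ = ∫⁻ w, K w := by
      rw [hν, withDensity_apply _ .univ, setLIntegral_univ, hK1]
    have := eLpNorm'_le_eLpNorm'_mul_rpow_measure_univ (μ := ν) (f := H) one_pos hq
      ((hH.mono_ac hac).aestronglyMeasurable)
    simp only [eLpNorm'_eq_lintegral_enorm, enorm_eq_self, ENNReal.rpow_one, e1, e2, one_div,
      inv_one] at this
    calc _ ≤ ((∫⁻ w, K (z - w) * H w ^ q) ^ q⁻¹ * (∫⁻ w, K w) ^ (1 - q⁻¹)) ^ q := by
            gcongr
      _ = _ := by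
            rw [ENNReal.mul_rpow_of_nonneg _ _ hq0.le, ← ENNReal.rpow_mul, ← ENNReal.rpow_mul,
              inv_mul_cancel₀ hq0.ne', ENNReal.rpow_one, mul_comm,
              show (1 - q⁻¹) * q = q - 1 by field_simp]
  calc _ ≤ ∫⁻ z, (∫⁻ w, K w) ^ (q - 1) * ∫⁻ w, K (z - w) * H w ^ q := lintegral_mono key
    _ = (∫⁻ w, K w) ^ (q - 1) * ∫⁻ z, ∫⁻ w, K (z - w) * H w ^ q := by
        rw [lintegral_const_mul' _ _ (ENNReal.rpow_ne_top_of_nonneg (by linarith) hKfin)]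
    _ = (∫⁻ w, K w) ^ (q - 1) * ∫⁻ w, ∫⁻ z, K (z - w) * H w ^ q := by
        rw [lintegral_lintegral_swap]
        refine AEMeasurable.mul ?_ ?_
        · exact (hK.comp (measurable_fst.sub measurable_snd)).aemeasurable
        · exact (hH.pow_const q).comp_snd
    _ = (∫⁻ w, K w) ^ (q - 1) * ∫⁻ w, (∫⁻ w, K w) * H w ^ q := by
        congr 1
        refine lintegral_congr fun w => ?_
        have hm : Measurable fun z => K (z - w) := hK.comp (by fun_prop)
        rw [lintegral_mul_const _ hm, hK2]
    _ = (∫⁻ w, K w) ^ q * ∫⁻ w, H w ^ q := by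
        rw [lintegral_const_mul' _ _ hKfin, ← mul_assoc]
        congr 1
        nth_rewrite 2 [← ENNReal.rpow_one (∫⁻ w, K w)]
        rw [← ENNReal.rpow_add_of_nonneg _ _ (by linarith) zero_le_one]
        simp

lemma enorm_mul_weight (h : (Fin n → ℂ) → ℂ) (w : Fin n → ℂ) :
    ‖h w * (Real.exp (-sqNorm w / (2 * t)) : ℂ)‖ₑ
      = ‖h w‖ₑ * ENNReal.ofReal (Real.exp (-sqNorm w / (2 * t))) := by
  rw [enorm_mul, ← ofReal_norm (Complex.ofReal _), Complex.norm_real,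
    Real.norm_of_nonneg (Real.exp_pos _).le]

lemma one_le_toReal (hp : 1 ≤ p) (hp' : p ≠ ∞) : 1 ≤ p.toReal := by
  simpa using ENNReal.toReal_mono hp' hp

lemma memLp_weight_iff (ht : 0 < t) (hp : 1 ≤ p) (hp' : p ≠ ∞) (h : (Fin n → ℂ) → ℂ) :
    MemLp h p (gauss n (2 * t / p.toReal))
      ↔ MemLp (fun w => h w * (Real.exp (-sqNorm w / (2 * t)) : ℂ)) p := by
  have hq := one_le_toReal hp hp'
  have hp0 : p ≠ 0 := (zero_lt_one.trans_le hp).ne'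
  have ht' : 0 < 2 * t / p.toReal := by positivity
  have hc := continuous_sqNorm (n := n)
  have hw : Continuous fun w : Fin n → ℂ => (Real.exp (-sqNorm w / (2 * t)) : ℂ) := by fun_prop
  have hw' : Continuous fun w : Fin n → ℂ => (Real.exp (sqNorm w / (2 * t)) : ℂ) := by fun_prop
  have hm : AEStronglyMeasurable h (gauss n (2 * t / p.toReal))
      ↔ AEStronglyMeasurable (fun w => h w * (Real.exp (-sqNorm w / (2 * t)) : ℂ)) volume := by
    refine ⟨fun H => (H.mono_ac (ac_gauss ht')).mul hw.aestronglyMeasurable, fun H => ?_⟩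
    refine AEStronglyMeasurable.mono_ac (gauss_ac _)
      ((H.mul hw'.aestronglyMeasurable).congr (.of_forall fun w => ?_))
    simp only [Pi.mul_apply, mul_assoc, ← Complex.ofReal_mul,
      ← Real.exp_add]
    simp [neg_div]
  have hfin : eLpNorm h p (gauss n (2 * t / p.toReal)) < ∞
      ↔ eLpNorm (fun w => h w * (Real.exp (-sqNorm w / (2 * t)) : ℂ)) p volume < ∞ := by
    rw [eLpNorm_lt_top_iff_lintegral_rpow_enorm_lt_top hp0 hp',
      eLpNorm_lt_top_iff_lintegral_rpow_enorm_lt_top hp0 hp', lintegral_weight ht hq]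
    simp_rw [enorm_mul_weight]
    have hcst : ENNReal.ofReal ((Real.pi * (2 * t / p.toReal)) ^ n)⁻¹ ≠ 0 := by
      have : 0 < ((Real.pi * (2 * t / p.toReal)) ^ n)⁻¹ := by positivity
      simpa using this
    constructor
    · intro H
      exact ENNReal.lt_top_of_mul_ne_top_right H.ne hcst
    · exact fun H => ENNReal.mul_lt_top ENNReal.ofReal_lt_top H
  exact and_congr hm hfin

/-- Functions in `L^p(μ_{2t/p})` are integrable against `exp(M ∑ |wᵢ|) dμ_t(w)`. -/
lemma integrable_exp_mul (ht : 0 < t) (hp : 1 ≤ p) (hp' : p ≠ ∞) {h : (Fin n → ℂ) → ℂ}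
    (hh : MemLp h p (gauss n (2 * t / p.toReal))) (M : ℝ) :
    Integrable (fun w => Real.exp (M * oneNorm w) * ‖h w‖) (gauss n t) := by
  have hq := one_le_toReal hp hp'
  have hp0 : p ≠ 0 := (zero_lt_one.trans_le hp).ne'
  have hX := ((memLp_weight_iff ht hp hp' h).1 hh)
  have hXq := hX.integrable_norm_rpow hp0 hp'
  have hb : 0 < 1 / (2 * t) := by positivity
  have hG := integrable_exp_sqNorm (n := n) (half_pos hb)
  have hc := continuous_sqNorm (n := n)
  have hc1 := continuous_oneNorm (n := n)
  set C := Real.exp (n * (M ^ 2 / (2 * (1 / (2 * t)))))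
  have ht' : 0 < 2 * t / p.toReal := by positivity
  unfold gauss
  rw [integrable_withDensity_iff_integrable_smul' (measurable_dens t)
    (.of_forall fun w => ENNReal.ofReal_lt_top)]
  refine (((hG.const_mul C).add (hXq.const_mul C)).const_mul ((Real.pi * t) ^ n)⁻¹).mono' ?_
    (.of_forall fun w => ?_)
  · refine AEStronglyMeasurable.smul (measurable_dens t).ennreal_toReal.aestronglyMeasurable ?_
    refine AEStronglyMeasurable.mul ?_ (hh.1.mono_ac (ac_gauss ht')).norm
    exact Continuous.aestronglyMeasurable (by fun_prop)
  · have e1 := exp_oneNorm_le hb M w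
    have e2 : Real.exp (-(1 / (2 * t) / 2) * sqNorm w) ≤ 1 := by
      have := sqNorm_nonneg w
      rw [Real.exp_le_one_iff]
      have : 0 ≤ (1 / (2 * t) / 2) * sqNorm w := by positivity
      linarith
    simp only [Pi.add_apply, norm_mul, Complex.norm_real]
    set X := ‖h w‖ * ‖Real.exp (-sqNorm w / (2 * t))‖ with hXdef
    have hX0 : 0 ≤ X := by positivity
    have e3 : X ≤ 1 + X ^ p.toReal := by
      rcases le_total X 1 with h1 | h1
      · have : 0 ≤ X ^ p.toReal := by positivity
        linarith
      · have := Real.self_le_rpow_of_one_le h1 hq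
        linarith
    rw [ENNReal.toReal_ofReal (by positivity), smul_eq_mul, Real.norm_of_nonneg (by positivity),
      mul_assoc]
    refine mul_le_mul_of_nonneg_left ?_ (by positivity)
    have e4 : Real.exp (-sqNorm w / t) * (Real.exp (M * oneNorm w) * ‖h w‖)
        = Real.exp (M * oneNorm w - 1 / (2 * t) * sqNorm w) * X := by
      rw [hXdef, Real.norm_of_nonneg (Real.exp_pos _).le, ← mul_assoc, ← Real.exp_add,
        mul_comm ‖h w‖, ← mul_assoc, ← Real.exp_add]
      congr 2
      field_simp
      ring
    rw [e4]
    set E := Real.exp (-(1 / (2 * t) / 2) * sqNorm w)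
    have hE : 0 ≤ E := (Real.exp_pos _).le
    have hC : 0 ≤ C := (Real.exp_pos _).le
    calc _ ≤ (C * E) * X := mul_le_mul_of_nonneg_right e1 hX0
      _ ≤ (C * E) * (1 + X ^ p.toReal) := mul_le_mul_of_nonneg_left e3 (by positivity)
      _ = C * E + C * (E * X ^ p.toReal) := by ring
      _ ≤ C * E + C * (1 * X ^ p.toReal) := by gcongr
      _ = _ := by rw [one_mul]

lemma integrable_kernel_mul (ht : 0 < t) (hp : 1 ≤ p) (hp' : p ≠ ∞) {h : (Fin n → ℂ) → ℂ}
    (hh : MemLp h p (gauss n (2 * t / p.toReal))) (z : Fin n → ℂ) :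
    Integrable (fun w => cexp (herm z w / t) * h w) (gauss n t) := by
  have ht' : 0 < 2 * t / p.toReal := by
    have := one_le_toReal hp hp'
    positivity
  have hc := continuous_herm_right z
  refine (integrable_exp_mul ht hp hp' hh (‖z‖ / t)).mono' ?_ (.of_forall fun w => ?_)
  · exact (Continuous.aestronglyMeasurable (by fun_prop)).mul
      (hh.1.mono_ac ((gauss_ac _).trans (ac_gauss ht')))
  · rw [norm_mul, Complex.norm_exp]
    gcongr
    calc (herm z w / t).re ≤ ‖herm z w / t‖ := Complex.re_le_norm _
      _ = ‖herm z w‖ / t := by rw [norm_div, Complex.norm_real, Real.norm_of_nonneg ht.le]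
      _ ≤ ‖z‖ * oneNorm w / t := by gcongr; exact norm_herm_le z w
      _ = _ := by ring

/-- `z ↦ z · w̄` as a continuous linear map. -/
def hermCLM (w : Fin n → ℂ) : (Fin n → ℂ) →L[ℂ] ℂ :=
  ∑ i, conj (w i) • ContinuousLinearMap.proj i

lemma hermCLM_apply (w z : Fin n → ℂ) : hermCLM w z = herm z w := by
  simp [hermCLM, herm, mul_comm]

lemma norm_hermCLM_le (w : Fin n → ℂ) : ‖hermCLM w‖ ≤ oneNorm w :=
  ContinuousLinearMap.opNorm_le_bound _ (oneNorm_nonneg w) fun z => by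
    rw [hermCLM_apply, mul_comm]; exact norm_herm_le z w

/-- `P_t h` is holomorphic for `h` in `L^p(μ_{2t/p})`. -/
lemma differentiable_bargmann (ht : 0 < t) (hp : 1 ≤ p) (hp' : p ≠ ∞) {h : (Fin n → ℂ) → ℂ}
    (hh : MemLp h p (gauss n (2 * t / p.toReal))) : Differentiable ℂ (bargmann t h) := by
  intro z₀
  have ht' : 0 < 2 * t / p.toReal := by
    have := one_le_toReal hp hp'
    positivity
  have hmeas : AEStronglyMeasurable h (gauss n t) :=
    hh.1.mono_ac ((gauss_ac _).trans (ac_gauss ht'))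
  have hL : Continuous fun w : Fin n → ℂ => (t : ℂ)⁻¹ • hermCLM w := by
    unfold hermCLM
    fun_prop
  have hc := continuous_herm_right z₀
  refine (hasFDerivAt_integral_of_dominated_of_fderiv_le
    (F := fun z w => cexp (herm z w / t) * h w)
    (F' := fun z w => (cexp (herm z w / t) * h w) • ((t : ℂ)⁻¹ • hermCLM w))
    (bound := fun w => t⁻¹ * (Real.exp (((‖z₀‖ + 1) / t + 1) * oneNorm w) * ‖h w‖))
    (Metric.ball_mem_nhds z₀ one_pos)
    (.of_forall fun z => (integrable_kernel_mul ht hp hp' hh z).1)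
    (integrable_kernel_mul ht hp hp' hh z₀) ?_ (.of_forall fun w z hz => ?_)
    ((integrable_exp_mul ht hp hp' hh _).const_mul _)
    (.of_forall fun w z _ => ?_)).differentiableAt
  · exact (integrable_kernel_mul ht hp hp' hh z₀).1.smul hL.aestronglyMeasurable
  · have hz' : ‖z‖ ≤ ‖z₀‖ + 1 := by
      have h1 : ‖z - z₀‖ < 1 := by simpa [dist_eq_norm] using hz
      have h2 := norm_le_norm_add_norm_sub z₀ z
      have h3 := norm_sub_rev z z₀
      have : ‖z‖ ≤ ‖z₀‖ + ‖z - z₀‖ := by simpa using norm_add_le z₀ (z - z₀)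
      linarith
    have hS := oneNorm_nonneg w
    have e1 : (herm z w / t).re ≤ (‖z₀‖ + 1) / t * oneNorm w :=
      calc (herm z w / t).re ≤ ‖herm z w / t‖ := Complex.re_le_norm _
        _ = ‖herm z w‖ / t := by rw [norm_div, Complex.norm_real, Real.norm_of_nonneg ht.le]
        _ ≤ ‖z‖ * oneNorm w / t := by gcongr; exact norm_herm_le z w
        _ ≤ (‖z₀‖ + 1) * oneNorm w / t := by gcongr
        _ = _ := by ring
    have e2 : ‖hermCLM w‖ ≤ Real.exp (oneNorm w) :=
      (norm_hermCLM_le w).trans ((by linarith : oneNorm w ≤ oneNorm w + 1).trans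
        (Real.add_one_le_exp _))
    rw [norm_smul, norm_smul, norm_mul, Complex.norm_exp, norm_inv, Complex.norm_real,
      Real.norm_of_nonneg ht.le, add_mul, one_mul, Real.exp_add]
    calc Real.exp (herm z w / t).re * ‖h w‖ * (t⁻¹ * ‖hermCLM w‖)
        ≤ Real.exp ((‖z₀‖ + 1) / t * oneNorm w) * ‖h w‖ * (t⁻¹ * Real.exp (oneNorm w)) := by
          gcongr
      _ = _ := by ring
  · have h1 : HasFDerivAt (fun z => herm z w / t) ((t : ℂ)⁻¹ • hermCLM w) z := by
      have := ((t : ℂ)⁻¹ • hermCLM w).hasFDerivAt (x := z)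
      refine this.congr_of_eventuallyEq (.of_forall fun u => ?_)
      simp [hermCLM_apply, div_eq_inv_mul]
    have h2 := h1.cexp.mul_const (h w)
    refine h2.congr_fderiv ?_
    ext u
    simp
    ring

lemma lintegral_kernel (ht : 0 < t) :
    ∫⁻ u : Fin n → ℂ, ENNReal.ofReal (((Real.pi * t) ^ n)⁻¹ * Real.exp (-sqNorm u / (2 * t)))
      = ENNReal.ofReal (2 ^ n) := by
  have hb : 0 < 1 / (2 * t) := by positivity
  have h1 := (integrable_exp_sqNorm (n := n) hb).const_mul ((Real.pi * t) ^ n)⁻¹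
  have h2 : ∀ u : Fin n → ℂ, ((Real.pi * t) ^ n)⁻¹ * Real.exp (-sqNorm u / (2 * t))
      = ((Real.pi * t) ^ n)⁻¹ * Real.exp (-(1 / (2 * t)) * sqNorm u) := by
    intro u; congr 2; ring
  simp_rw [h2]
  rw [← ofReal_integral_eq_lintegral_ofReal h1 (.of_forall fun u => by positivity),
    integral_const_mul, integral_exp_sqNorm hb, ← inv_pow, ← mul_pow]
  congr 2
  field_simp

/-- `P_t` is bounded on `L^p(μ_{2t/p})`. -/
lemma lintegral_bargmann_le (ht : 0 < t) {q : ℝ} (hq : 1 ≤ q) {h : (Fin n → ℂ) → ℂ}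
    (hh : AEStronglyMeasurable h) :
    ∫⁻ z, ‖bargmann t h z‖ₑ ^ q ∂(gauss n (2 * t / q))
      ≤ ENNReal.ofReal (2 ^ n) ^ q * ∫⁻ z, ‖h z‖ₑ ^ q ∂(gauss n (2 * t / q)) := by
  have hc := continuous_sqNorm (n := n)
  set K : (Fin n → ℂ) → ℝ≥0∞ := fun u =>
    ENNReal.ofReal (((Real.pi * t) ^ n)⁻¹ * Real.exp (-sqNorm u / (2 * t))) with hKdef
  set H : (Fin n → ℂ) → ℝ≥0∞ := fun w =>
    ‖h w‖ₑ * ENNReal.ofReal (Real.exp (-sqNorm w / (2 * t))) with hHdef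
  have hK : Measurable K := Measurable.ennreal_ofReal (by fun_prop)
  have hH : AEMeasurable H := hh.enorm.mul
    (Measurable.ennreal_ofReal (by fun_prop)).aemeasurable
  have key : ∀ z, ‖bargmann t h z‖ₑ * ENNReal.ofReal (Real.exp (-sqNorm z / (2 * t)))
      ≤ ∫⁻ w, K (z - w) * H w := by
    intro z
    unfold bargmann
    rw [integral_gauss ht]
    refine (mul_le_mul_left (enorm_integral_le_lintegral_enorm _) _).trans ?_
    rw [← lintegral_mul_const' _ _ ENNReal.ofReal_ne_top]
    refine lintegral_mono fun w => le_of_eq ?_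
    have e : ((Real.pi * t) ^ n)⁻¹ * Real.exp (-sqNorm w / t) * Real.exp (herm z w / t).re
          * Real.exp (-sqNorm z / (2 * t))
        = ((Real.pi * t) ^ n)⁻¹ * Real.exp (-sqNorm (z - w) / (2 * t))
          * Real.exp (-sqNorm w / (2 * t)) := by
      simp only [mul_assoc, ← Real.exp_add]
      congr 2
      rw [sqNorm_sub, Complex.div_ofReal_re]
      field_simp
      ring
    have e' := congrArg ENNReal.ofReal e
    rw [ENNReal.ofReal_mul (q := Real.exp (-sqNorm z / (2 * t))) (by positivity),
      ENNReal.ofReal_mul (q := Real.exp (herm z w / t).re) (by positivity),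
      ENNReal.ofReal_mul (q := Real.exp (-sqNorm w / (2 * t))) (by positivity)] at e'
    simp only [hKdef, hHdef, enorm_mul]
    rw [← ofReal_norm (Complex.ofReal _), ← ofReal_norm (cexp _), Complex.norm_exp,
      Complex.norm_real, Real.norm_of_nonneg (by positivity), mul_left_comm _ ‖h w‖ₑ, ← e']
    ring
  rw [lintegral_weight ht hq, lintegral_weight ht hq, mul_left_comm]
  gcongr
  refine (lintegral_mono fun z => ENNReal.rpow_le_rpow (key z) (by linarith)).trans ?_
  have := young hq hK (by rw [hKdef, lintegral_kernel ht]; exact ENNReal.ofReal_ne_top) hH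
  rwa [hKdef, lintegral_kernel ht] at this

lemma eLpNorm_bargmann_le (ht : 0 < t) (hp : 1 ≤ p) (hp' : p ≠ ∞) {h : (Fin n → ℂ) → ℂ}
    (hh : AEStronglyMeasurable h) :
    eLpNorm (bargmann t h) p (gauss n (2 * t / p.toReal))
      ≤ ENNReal.ofReal (2 ^ n) * eLpNorm h p (gauss n (2 * t / p.toReal)) := by
  have hq := one_le_toReal hp hp'
  have hp0 : p ≠ 0 := (zero_lt_one.trans_le hp).ne'
  rw [eLpNorm_eq_lintegral_rpow_enorm_toReal hp0 hp',
    eLpNorm_eq_lintegral_rpow_enorm_toReal hp0 hp']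
  refine (ENNReal.rpow_le_rpow (lintegral_bargmann_le ht hq hh) (by positivity)).trans_eq ?_
  rw [ENNReal.mul_rpow_of_nonneg _ _ (by positivity), ← ENNReal.rpow_mul, mul_one_div,
    div_self (by positivity), ENNReal.rpow_one]

lemma measurePreserving_rotate (θ : ℝ) :
    MeasurePreserving (fun u : Fin n → ℂ => circleMap 0 1 θ • u) := by
  have h1 : MeasurePreserving (fun z : ℂ => circleMap 0 1 θ * z) := by
    have := (rotation (Circle.exp θ)).measurePreserving
    convert this using 2 with z
    simp [circleMap]
  exact volume_preserving_pi (fun _ : Fin n => h1)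

lemma sqNorm_rotate (θ : ℝ) (u : Fin n → ℂ) : sqNorm (circleMap 0 1 θ • u) = sqNorm u := by
  simp [sqNorm]

/-- Gaussian mean value property of entire functions on `ℂⁿ`. -/
lemma integral_mul_exp_eq (ht : 0 < t) {G : (Fin n → ℂ) → ℂ} (hG : Differentiable ℂ G)
    (hint : Integrable fun u => G u * (Real.exp (-sqNorm u / t) : ℂ)) :
    ∫ u, G u * (Real.exp (-sqNorm u / t) : ℂ) = (Real.pi * t : ℂ) ^ n * G 0 := by
  have hc := continuous_sqNorm (n := n)
  have hGc := hG.continuous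
  set φ : (Fin n → ℂ) → ℂ := fun u => G u * (Real.exp (-sqNorm u / t) : ℂ) with hφ
  set F : (Fin n → ℂ) → ℝ → ℂ := fun u θ => φ (circleMap 0 1 θ • u) with hF
  set ν : Measure ℝ := volume.restrict (Set.Ioc 0 (2 * Real.pi)) with hν
  have hmp := fun θ => measurePreserving_rotate (n := n) θ
  have hφc : Continuous φ := by fun_prop
  have hFi : Integrable (Function.uncurry F) (volume.prod ν) := by
    have hcm : Continuous fun θ : ℝ => circleMap 0 1 θ := continuous_circleMap 0 1
    have hFc : Continuous (Function.uncurry F) := by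
      simp only [hF, Function.uncurry_def]
      fun_prop
    rw [integrable_prod_iff' hFc.aestronglyMeasurable]
    refine ⟨.of_forall fun θ => (hmp θ).integrable_comp_of_integrable hint, ?_⟩
    have : (fun θ : ℝ => ∫ u, ‖Function.uncurry F (u, θ)‖) = fun _ => ∫ u, ‖φ u‖ := by
      funext θ
      have := integral_map (μ := volume) (hmp θ).measurable.aemeasurable (f := fun u => ‖φ u‖)
        hφc.norm.aestronglyMeasurable
      rw [(hmp θ).map_eq] at this
      exact this.symm
    rw [this]
    exact integrable_const _
  have hrot : ∀ θ, ∫ u, F u θ = ∫ u, φ u := fun θ => by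
    have := integral_map (μ := volume) (hmp θ).measurable.aemeasurable (f := φ) hφc.aestronglyMeasurable
    rw [(hmp θ).map_eq] at this
    exact this.symm
  have hswap := integral_integral_swap hFi
  simp only [hrot, integral_const] at hswap
  have hinner : ∀ u, ∫ θ, F u θ ∂ν = (2 * Real.pi : ℂ) * (G 0 * (Real.exp (-sqNorm u / t) : ℂ)) := by
    intro u
    have hd : Differentiable ℂ fun c : ℂ => G (c • u) := by
      have : Differentiable ℂ fun c : ℂ => c • u := by fun_prop
      exact hG.comp this
    have := (hd.diffContOnCl (s := Metric.ball 0 |1|)).circleAverage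
    rw [Real.circleAverage_def, intervalIntegral.integral_of_le Real.two_pi_pos.le] at this
    simp only [hF, hφ, sqNorm_rotate, integral_mul_const]
    rw [zero_smul] at this
    rw [← this, hν, Complex.real_smul]
    push_cast
    have : (Real.pi : ℂ) ≠ 0 := by exact_mod_cast Real.pi_ne_zero
    field_simp
  simp only [hinner, integral_const_mul] at hswap
  have hval : ∫ u : Fin n → ℂ, (Real.exp (-sqNorm u / t) : ℂ) = (Real.pi * t : ℂ) ^ n := by
    have h1 := integral_exp_sqNorm (n := n) (b := 1 / t) (by positivity)
    have h2 : ∀ u : Fin n → ℂ, -sqNorm u / t = -(1 / t) * sqNorm u := fun u => by ring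
    simp_rw [h2]
    rw [integral_complex_ofReal, h1]
    push_cast
    congr 1
    field_simp
  rw [hval] at hswap
  have hv : ν.real Set.univ = 2 * Real.pi := by
    simp [hν, Real.pi_pos.le]
  rw [hv, Complex.real_smul] at hswap
  have h2 : (2 * Real.pi : ℂ) ≠ 0 := by exact_mod_cast Real.two_pi_pos.ne'
  push_cast at hswap
  have := mul_left_cancel₀ h2 hswap
  rw [← this]; ring

/-- The reproducing property: `P_t g = g` for holomorphic `g` in `L^p(μ_{2t/p})`. -/
lemma bargmann_eq_self (ht : 0 < t) (hp : 1 ≤ p) (hp' : p ≠ ∞) {g : (Fin n → ℂ) → ℂ}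
    (hg : Differentiable ℂ g) (hh : MemLp g p (gauss n (2 * t / p.toReal))) :
    bargmann t g = g := by
  funext z
  set c : ℝ := ((Real.pi * t) ^ n)⁻¹ with hcdef
  have hc0 : (c : ℂ) ≠ 0 := by
    have : c ≠ 0 := by positivity
    exact_mod_cast this
  set ψ : (Fin n → ℂ) → ℂ := fun w =>
    ((c * Real.exp (-sqNorm w / t) : ℝ) : ℂ) * (cexp (herm z w / t) * g w) with hψ
  set G : (Fin n → ℂ) → ℂ := fun u => cexp (-herm u z / t) * g (u + z) with hGdef
  have hi : Integrable ψ := by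
    have := integrable_kernel_mul ht hp hp' hh z
    unfold gauss at this
    rw [integrable_withDensity_iff_integrable_smul' (measurable_dens t)
      (.of_forall fun w => ENNReal.ofReal_lt_top)] at this
    refine this.congr (.of_forall fun w => ?_)
    simp only [hψ]
    rw [ENNReal.toReal_ofReal (by positivity), Complex.real_smul]
  have hshift : ∀ u, ψ (u + z) = c * (G u * (Real.exp (-sqNorm u / t) : ℂ)) := by
    intro u
    have e : cexp (-herm (u + z) (u + z) / t) * cexp (herm z (u + z) / t)
        = cexp (-herm u z / t) * cexp (-herm u u / t) := by
      rw [← Complex.exp_add, ← Complex.exp_add, herm_add_left, herm_add_right u,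
        herm_add_right z]
      congr 1
      ring
    simp only [hψ, hGdef]
    push_cast
    rw [sqNorm_eq_herm, sqNorm_eq_herm]
    linear_combination (c : ℂ) * g (u + z) * e
  have hGd : Differentiable ℂ G := by
    have h1 : Differentiable ℂ fun u : Fin n → ℂ => herm u z := by
      unfold herm; fun_prop
    have h2 : Differentiable ℂ fun u : Fin n → ℂ => g (u + z) := hg.comp (by fun_prop)
    have h3 : Differentiable ℂ fun u : Fin n → ℂ => -herm u z / t := by
      simp only [div_eq_mul_inv]
      exact h1.neg.mul_const _
    exact h3.cexp.mul h2
  have hGi : Integrable fun u => G u * (Real.exp (-sqNorm u / t) : ℂ) := by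
    have := (hi.comp_add_right z).const_mul (c : ℂ)⁻¹
    refine this.congr (.of_forall fun u => ?_)
    simp only [hshift]
    rw [inv_mul_cancel_left₀ hc0]
  unfold bargmann
  rw [integral_gauss ht, ← integral_add_right_eq_self _ z]
  change ∫ u, ψ (u + z) = g z
  simp only [hshift]
  rw [integral_const_mul, integral_mul_exp_eq ht hGd hGi]
  have hz : G 0 = g z := by simp [hGdef, herm]
  have : (c : ℂ) * (Real.pi * t : ℂ) ^ n = 1 := by
    have h1 : c * (Real.pi * t) ^ n = 1 := inv_mul_cancel₀ (by positivity)
    exact_mod_cast h1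
  rw [hz, ← mul_assoc, this, one_mul]

/-- The subspace of those classes in `L^p(ℂⁿ, μ_{2t/p})` that have an entire representative. -/
def fockSubmodule (n : ℕ) (t : ℝ) (p : ℝ≥0∞) :
    Submodule ℂ (Lp ℂ p (gauss n (2 * t / p.toReal))) where
  carrier := {f | ∃ g : (Fin n → ℂ) → ℂ, Differentiable ℂ g ∧
    f =ᵐ[gauss n (2 * t / p.toReal)] g}
  zero_mem' := ⟨0, differentiable_const _, Lp.coeFn_zero _ _ _⟩
  add_mem' := by
    rintro a b ⟨g, hg, hag⟩ ⟨g', hg', hbg⟩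
    exact ⟨g + g', hg.add hg', (Lp.coeFn_add a b).trans (hag.add hbg)⟩
  smul_mem' := by
    rintro c a ⟨g, hg, hag⟩
    exact ⟨c • g, hg.const_smul c, (Lp.coeFn_smul c a).trans (hag.const_smul c)⟩

/-- The `p`-Fock space `F_t^p = L^p(ℂⁿ, μ_{2t/p}) ∩ Hol(ℂⁿ)` with the norm of `L^p(μ_{2t/p})`. -/
def FockSpace (n : ℕ) (t : ℝ) (p : ℝ≥0∞) : Type := fockSubmodule n t p

instance instNormedAddCommGroup [Fact (1 ≤ p)] : NormedAddCommGroup (FockSpace n t p) :=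
  inferInstanceAs (NormedAddCommGroup (fockSubmodule n t p))

instance instNormedSpace [Fact (1 ≤ p)] : NormedSpace ℂ (FockSpace n t p) :=
  inferInstanceAs (NormedSpace ℂ (fockSubmodule n t p))

/-- The inclusion of `F_t^p` in `L^p(μ_{2t/p})`. -/
def toLp [Fact (1 ≤ p)] : FockSpace n t p →L[ℂ] Lp ℂ p (gauss n (2 * t / p.toReal)) :=
  (fockSubmodule n t p).subtypeL

/-- For `p = 2` the inner product is the one of `L²(μ_t)`. -/
instance instInnerProductSpace : InnerProductSpace ℂ (FockSpace n t 2) where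
  toNormedSpace := instNormedSpace
  inner f g := inner ℂ (toLp f) (toLp g)
  norm_sq_eq_re_inner f := norm_sq_eq_re_inner (toLp f)
  conj_inner_symm f g := inner_conj_symm (toLp f) (toLp g)
  add_left f g h := inner_add_left (toLp f) (toLp g) (toLp h)
  smul_left f g c := inner_smul_left (toLp f) (toLp g) c

lemma toLp_injective [Fact (1 ≤ p)] : Function.Injective (toLp (n := n) (t := t) (p := p)) :=
  Subtype.val_injective

lemma gauss_ac_gauss {s : ℝ} (hs : 0 < s) (t : ℝ) : gauss n t ≪ gauss n s :=
  (gauss_ac t).trans (ac_gauss hs)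

lemma bargmann_congr (hs : 0 < 2 * t / p.toReal) {f g : (Fin n → ℂ) → ℂ}
    (h : f =ᵐ[gauss n (2 * t / p.toReal)] g) : bargmann t f = bargmann t g := by
  funext z
  refine integral_congr_ae ?_
  filter_upwards [(gauss_ac_gauss hs t).ae_eq h] with w hw
  rw [hw]

lemma exponent_pos (ht : 0 < t) (hp : 1 ≤ p) (hp' : p ≠ ∞) : 0 < 2 * t / p.toReal := by
  have := one_le_toReal hp hp'
  positivity

lemma memLp_bargmann (ht : 0 < t) (hp : 1 ≤ p) (hp' : p ≠ ∞) {h : (Fin n → ℂ) → ℂ}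
    (hh : MemLp h p (gauss n (2 * t / p.toReal))) :
    MemLp (bargmann t h) p (gauss n (2 * t / p.toReal)) :=
  ⟨(differentiable_bargmann ht hp hp' hh).continuous.aestronglyMeasurable,
    (eLpNorm_bargmann_le ht hp hp' (hh.1.mono_ac (ac_gauss (exponent_pos ht hp hp')))).trans_lt
      (ENNReal.mul_lt_top ENNReal.ofReal_lt_top hh.2)⟩

lemma bargmann_add (ht : 0 < t) (hp : 1 ≤ p) (hp' : p ≠ ∞) {f g : (Fin n → ℂ) → ℂ}
    (hf : MemLp f p (gauss n (2 * t / p.toReal))) (hg : MemLp g p (gauss n (2 * t / p.toReal))) :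
    bargmann t (f + g) = bargmann t f + bargmann t g := by
  funext z
  simp only [bargmann, Pi.add_apply, mul_add]
  exact integral_add (integrable_kernel_mul ht hp hp' hf z) (integrable_kernel_mul ht hp hp' hg z)

lemma bargmann_smul (c : ℂ) (f : (Fin n → ℂ) → ℂ) :
    bargmann t (c • f) = c • bargmann t f := by
  funext z
  simp only [bargmann, Pi.smul_apply, smul_eq_mul, ← integral_const_mul]
  refine integral_congr_ae (.of_forall fun w => ?_)
  ring

/-- The operator `P_t` as a bounded operator on `L^p(μ_{2t/p})`. -/
def bargmannLp (n : ℕ) (t : ℝ) (p : ℝ≥0∞) [ht : Fact (0 < t)] [hp : Fact (1 ≤ p)]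
    [hp' : Fact (p ≠ ∞)] :
    Lp ℂ p (gauss n (2 * t / p.toReal)) →L[ℂ] Lp ℂ p (gauss n (2 * t / p.toReal)) :=
  LinearMap.mkContinuous
    { toFun := fun h => (memLp_bargmann ht.out hp.out hp'.out (Lp.memLp h)).toLp
      map_add' := fun f g => by
        have hf := memLp_bargmann ht.out hp.out hp'.out (Lp.memLp f)
        have hg := memLp_bargmann ht.out hp.out hp'.out (Lp.memLp g)
        rw [← MemLp.toLp_add hf hg]
        refine MemLp.toLp_congr _ _ (.of_eq ?_)
        rw [← bargmann_add ht.out hp.out hp'.out (Lp.memLp f) (Lp.memLp g)]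
        exact bargmann_congr (exponent_pos ht.out hp.out hp'.out) (Lp.coeFn_add f g)
      map_smul' := fun c f => by
        have hf := memLp_bargmann ht.out hp.out hp'.out (Lp.memLp f)
        rw [RingHom.id_apply, ← MemLp.toLp_const_smul c hf]
        refine MemLp.toLp_congr _ _ (.of_eq ?_)
        rw [← bargmann_smul]
        exact bargmann_congr (exponent_pos ht.out hp.out hp'.out) (Lp.coeFn_smul c f) }
    (2 ^ n) fun h => by
      have hm := (Lp.memLp h).1.mono_ac (ac_gauss (exponent_pos ht.out hp.out hp'.out))
      have := eLpNorm_bargmann_le ht.out hp.out hp'.out hm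
      refine (Lp.norm_toLp _ (memLp_bargmann ht.out hp.out hp'.out (Lp.memLp h))).trans_le ?_
      rw [Lp.norm_def]
      refine (ENNReal.toReal_mono (ENNReal.mul_ne_top ENNReal.ofReal_ne_top (Lp.memLp h).2.ne)
        this).trans_eq ?_
      rw [ENNReal.toReal_mul, ENNReal.toReal_ofReal (by positivity)]

lemma coeFn_bargmannLp [ht : Fact (0 < t)] [hp : Fact (1 ≤ p)] [hp' : Fact (p ≠ ∞)]
    (h : Lp ℂ p (gauss n (2 * t / p.toReal))) :
    bargmannLp n t p h =ᵐ[gauss n (2 * t / p.toReal)] bargmann t h :=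
  MemLp.coeFn_toLp (memLp_bargmann ht.out hp.out hp'.out (Lp.memLp h))

lemma bargmannLp_mem [ht : Fact (0 < t)] [hp : Fact (1 ≤ p)] [hp' : Fact (p ≠ ∞)]
    (h : Lp ℂ p (gauss n (2 * t / p.toReal))) : bargmannLp n t p h ∈ fockSubmodule n t p :=
  ⟨bargmann t h, differentiable_bargmann ht.out hp.out hp'.out (Lp.memLp h), coeFn_bargmannLp h⟩

lemma bargmannLp_of_mem [ht : Fact (0 < t)] [hp : Fact (1 ≤ p)] [hp' : Fact (p ≠ ∞)]
    {f : Lp ℂ p (gauss n (2 * t / p.toReal))} (hf : f ∈ fockSubmodule n t p) :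
    bargmannLp n t p f = f := by
  obtain ⟨g, hg, hfg⟩ := hf
  refine Lp.ext ((coeFn_bargmannLp f).trans (Filter.EventuallyEq.trans (.of_eq ?_) hfg.symm))
  rw [bargmann_congr (exponent_pos ht.out hp.out hp'.out) hfg]
  exact bargmann_eq_self ht.out hp.out hp'.out hg ((memLp_congr_ae hfg).1 (Lp.memLp f))

/-- `F_t^p` is a Banach space. -/
instance instCompleteSpace [Fact (0 < t)] [Fact (1 ≤ p)] [Fact (p ≠ ∞)] :
    CompleteSpace (FockSpace n t p) := by
  have hc : IsClosed (fockSubmodule n t p : Set (Lp ℂ p (gauss n (2 * t / p.toReal)))) := by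
    have : (fockSubmodule n t p : Set (Lp ℂ p (gauss n (2 * t / p.toReal))))
        = {f | bargmannLp n t p f = f} := by
      ext f
      refine ⟨fun hf => bargmannLp_of_mem hf, fun hf => ?_⟩
      have h : bargmannLp n t p f = f := hf
      rw [← h]
      exact bargmannLp_mem f
    rw [this]
    exact isClosed_eq (bargmannLp n t p).continuous continuous_id
  exact hc.completeSpace_coe

/-- The bounded projection `P_t : L^p(μ_{2t/p}) → F_t^p`. -/
def fockProj (n : ℕ) (t : ℝ) (p : ℝ≥0∞) [Fact (0 < t)] [Fact (1 ≤ p)] [Fact (p ≠ ∞)] :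
    Lp ℂ p (gauss n (2 * t / p.toReal)) →L[ℂ] FockSpace n t p :=
  (bargmannLp n t p).codRestrict (fockSubmodule n t p) bargmannLp_mem

instance instFactTwo : Fact ((2 : ℝ≥0∞) ≠ ∞) := ⟨ENNReal.ofNat_ne_top⟩

lemma memLp_bcf_mul (f : (Fin n → ℂ) →ᵇ ℂ) {μ : Measure (Fin n → ℂ)} {g : (Fin n → ℂ) → ℂ}
    (hg : MemLp g p μ) : MemLp (fun w => f w * g w) p μ :=
  MemLp.of_le_mul (c := ‖f‖) hg (f.continuous.aestronglyMeasurable.mul hg.1)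
    (.of_forall fun w => by
      rw [norm_mul]; gcongr; exact f.norm_coe_le_norm w)

/-- Multiplication by a bounded continuous function on `L^p`. -/
def mulSymbol (p : ℝ≥0∞) [Fact (1 ≤ p)] (μ : Measure (Fin n → ℂ)) (f : (Fin n → ℂ) →ᵇ ℂ) :
    Lp ℂ p μ →L[ℂ] Lp ℂ p μ :=
  LinearMap.mkContinuous
    { toFun := fun g => (memLp_bcf_mul f (Lp.memLp g)).toLp
      map_add' := fun g h => by
        rw [← MemLp.toLp_add (memLp_bcf_mul f (Lp.memLp g)) (memLp_bcf_mul f (Lp.memLp h))]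
        refine MemLp.toLp_congr _ _ ?_
        filter_upwards [Lp.coeFn_add g h] with w hw
        rw [hw, Pi.add_apply, Pi.add_apply, mul_add]
      map_smul' := fun c g => by
        rw [RingHom.id_apply, ← MemLp.toLp_const_smul c (memLp_bcf_mul f (Lp.memLp g))]
        refine MemLp.toLp_congr _ _ ?_
        filter_upwards [Lp.coeFn_smul c g] with w hw
        rw [hw, Pi.smul_apply, Pi.smul_apply, smul_eq_mul, smul_eq_mul, mul_left_comm] }
    ‖f‖ fun g => by
      refine Lp.norm_le_mul_norm_of_ae_le_mul ?_
      filter_upwards [MemLp.coeFn_toLp (memLp_bcf_mul f (Lp.memLp g))] with w hw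
      simp only [LinearMap.coe_mk, AddHom.coe_mk]
      rw [hw, norm_mul]
      gcongr
      exact f.norm_coe_le_norm w

/-- The Toeplitz operator `T_f^t g = P_t (f g)` on `F_t^p`. -/
def toeplitz (t : ℝ) (p : ℝ≥0∞) [Fact (0 < t)] [Fact (1 ≤ p)] [Fact (p ≠ ∞)]
    (f : (Fin n → ℂ) →ᵇ ℂ) : FockSpace n t p →L[ℂ] FockSpace n t p :=
  fockProj n t p ∘L mulSymbol p (gauss n (2 * t / p.toReal)) f ∘L toLp

lemma coeFn_toeplitz [ht : Fact (0 < t)] [hp : Fact (1 ≤ p)] [hp' : Fact (p ≠ ∞)]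
    (f : (Fin n → ℂ) →ᵇ ℂ) (g : FockSpace n t p) :
    toLp (toeplitz t p f g) =ᵐ[gauss n (2 * t / p.toReal)]
        bargmann t fun w => f w * toLp g w :=
  (coeFn_bargmannLp _).trans (.of_eq (bargmann_congr (exponent_pos ht.out hp.out hp'.out)
    (MemLp.coeFn_toLp (memLp_bcf_mul f (Lp.memLp (toLp g))))))

/-- The normalized reproducing kernel `k_z^t(w) = exp(w · z̄ / t - |z|² / (2t))`. -/
def normKernelFun (t : ℝ) (z w : Fin n → ℂ) : ℂ :=
  cexp (herm w z / t - sqNorm z / (2 * t))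

lemma differentiable_normKernelFun (t : ℝ) (z : Fin n → ℂ) :
    Differentiable ℂ (normKernelFun t z) := by
  have h1 : Differentiable ℂ fun w : Fin n → ℂ => herm w z := by
    unfold herm; fun_prop
  have h3 : Differentiable ℂ fun w : Fin n → ℂ => herm w z / t - sqNorm z / (2 * t) := by
    simp only [div_eq_mul_inv]
    exact (h1.mul_const _).sub_const _
  exact h3.cexp

lemma memLp_normKernelFun (ht : 0 < t) (hp : 1 ≤ p) (hp' : p ≠ ∞) (z : Fin n → ℂ) :
    MemLp (normKernelFun t z) p (gauss n (2 * t / p.toReal)) := by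
  have hq := one_le_toReal hp hp'
  have hp0 : p ≠ 0 := (zero_lt_one.trans_le hp).ne'
  have hc := continuous_sqNorm (n := n)
  have hk := (differentiable_normKernelFun t z).continuous
  rw [memLp_weight_iff ht hp hp', ← integrable_norm_rpow_iff
    (Continuous.aestronglyMeasurable (by fun_prop)) hp0 hp']
  have hb : 0 < p.toReal / (2 * t) := by positivity
  refine ((integrable_exp_sqNorm (n := n) hb).comp_sub_right z).congr (.of_forall fun w => ?_)
  simp only [normKernelFun]
  rw [norm_mul, Complex.norm_exp, Complex.norm_real, Real.norm_of_nonneg (Real.exp_pos _).le,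
    ← Real.exp_add, ← Real.exp_mul]
  congr 1
  have e : (herm w z / t - sqNorm z / (2 * t) : ℂ).re
      = (herm w z).re / t - sqNorm z / (2 * t) := by
    have : (sqNorm z / (2 * t) : ℂ) = ((sqNorm z / (2 * t) : ℝ) : ℂ) := by push_cast; rfl
    rw [this, Complex.sub_re, Complex.div_ofReal_re, Complex.ofReal_re]
  rw [e, sqNorm_sub]
  field_simp
  ring

/-- The normalized reproducing kernel `k_z^t` as an element of `F_t^p`. -/
def normKernel (t : ℝ) (p : ℝ≥0∞) [ht : Fact (0 < t)] [hp : Fact (1 ≤ p)] [hp' : Fact (p ≠ ∞)]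
    (z : Fin n → ℂ) : FockSpace n t p :=
  ⟨(memLp_normKernelFun ht.out hp.out hp'.out z).toLp, normKernelFun t z,
    differentiable_normKernelFun t z, MemLp.coeFn_toLp _⟩

/-- The Berezin transform `Ã(z) = ⟨A k_z^t, k_z^t⟩ = ∫ (A k_z^t)(w) conj (k_z^t(w)) dμ_t(w)`. -/
def berezin [Fact (0 < t)] [Fact (1 ≤ p)] [Fact (p ≠ ∞)]
    (A : FockSpace n t p →L[ℂ] FockSpace n t p) (z : Fin n → ℂ) : ℂ :=
  ∫ w, toLp (A (normKernel t p z)) w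
    * conj (normKernelFun t z w) ∂(gauss n t)

/-- `BUC(ℂⁿ)`: the bounded uniformly continuous functions, inside the bounded continuous functions
with the supremum norm. -/
def BUC (n : ℕ) : Submodule ℂ ((Fin n → ℂ) →ᵇ ℂ) where
  carrier := {f | UniformContinuous f}
  zero_mem' := uniformContinuous_const
  add_mem' := fun hf hg => UniformContinuous.add hf hg
  smul_mem' := fun c _ hf => UniformContinuous.const_smul hf c

/-- The translate `α_z f = f(· - z)`. -/
def translate (z : Fin n → ℂ) (f : (Fin n → ℂ) →ᵇ ℂ) : (Fin n → ℂ) →ᵇ ℂ :=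
  f.compContinuous ⟨fun w => w - z, by fun_prop⟩

/-- Translation invariance (`α`-invariance) of a set of symbols. -/
def TranslationInvariant (S : Set ((Fin n → ℂ) →ᵇ ℂ)) : Prop :=
  ∀ z, ∀ f ∈ S, translate z f ∈ S

section Algebras

variable (t : ℝ) (p : ℝ≥0∞) [Fact (0 < t)] [Fact (1 ≤ p)] [Fact (p ≠ ∞)]
  (S : Set ((Fin n → ℂ) →ᵇ ℂ))

/-- `T_lin^{p,t}(S)`: the closed linear span of the Toeplitz operators with symbols in `S`. -/
def toeplitzLin : Submodule ℂ (FockSpace n t p →L[ℂ] FockSpace n t p) :=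
  (Submodule.span ℂ (toeplitz t p '' S)).topologicalClosure

/-- `T^{p,t}(S)`: the (not necessarily unital) Banach algebra generated by the Toeplitz operators
with symbols in `S`. -/
def toeplitzAlg : NonUnitalSubalgebra ℂ (FockSpace n t p →L[ℂ] FockSpace n t p) :=
  (NonUnitalAlgebra.adjoin ℂ (toeplitz t p '' S)).topologicalClosure

/-- `T_*^{2,t}(S)`: the (not necessarily unital) `C*`-algebra generated by the Toeplitz operators
with symbols in `S` on the Hilbert space `F_t^2`. -/
def toeplitzStarAlg : NonUnitalStarSubalgebra ℂ (FockSpace n t 2 →L[ℂ] FockSpace n t 2) :=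
  (NonUnitalStarAlgebra.adjoin ℂ (toeplitz t 2 '' S)).topologicalClosure

/-- `S` is closed under the product maps `(f₁, …, f_k) ↦ (T_{f₁}^t ⋯ T_{f_k}^t)~`, `k ≥ 1`, formed
on `F_t^p`. -/
def ClosedUnderProductMaps : Prop :=
  ∀ k : ℕ, 1 ≤ k → ∀ f : Fin k → ((Fin n → ℂ) →ᵇ ℂ), (∀ i, f i ∈ S) →
    ∃ g ∈ S, ∀ z, berezin (List.ofFn fun i => toeplitz t p (f i)).prod z = g z

end Algebras

end Fock

end

noncomputable section

namespace Fock

variable {n : ℕ} {t : ℝ} {p : ℝ≥0∞}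

/-! The proof is a correspondence between translation invariant spaces of symbols and shift
invariant spaces of operators. The group `ℂⁿ` acts on operators by conjugation with the isometric
Weyl operators (`shift`). The Berezin transform intertwines this action with translation
(`berezin_shift`), and so does the Toeplitz quantization (`shift_toeplitz`). The transform of `T_f`
is the Gaussian average of `f` (`berezin_toeplitz`).

The Berezin transform is injective (`eq_zero_of_berezin_eq_zero`). Comparing transforms therefore
shows that, for an operator `A` with norm continuous orbit and bounded continuous transform, the
Gaussian average of its shifts is the Toeplitz operator with symbol `Ã`
(`integral_shift_eq_toeplitz`). The average can be undone: a closed subspace containing the Gaussian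
averages of a bounded continuous orbit around every point contains the orbit itself
(`mem_of_gauss_average_mem`). By Hahn-Banach this reduces to scalar functions, where it is a
uniqueness theorem for Gaussian convolution.

Hence an `A` with norm continuous orbit and `Ã ∈ D₀` lies in the closed span
(`mem_toeplitzLin_of_berezin_mem`). Conversely, transforms of elements of the closed span lie in
`D₀`, because `D₀` is closed and the transform is bounded into the supremum norm
(`berezin_mem_of_mem_toeplitzLin`). Products of Toeplitz operators with symbols in `D₀` have norm
continuous orbits, so all of them lie in the closed span exactly when `(∗)` holds.

For the `C*` statement, `star_toeplitz` identifies the adjoint of `T_f` with the operator of the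
conjugate symbol. If the conjugate symbols give operators in the closed span, their Gaussian
averages lie in `D₀`, and `mem_of_gauss_average_mem`, now applied to functions, recovers the symbols
themselves. -/

/-! ### Inverting Gaussian averages. -/

lemma isProbabilityMeasure_gauss (ht : 0 < t) : IsProbabilityMeasure (gauss n t) := by
  refine ⟨?_⟩
  have hb : 0 < 1 / t := by positivity
  have h1 := (integrable_exp_sqNorm (n := n) hb).const_mul ((Real.pi * t) ^ n)⁻¹
  have h2 : ∀ u : Fin n → ℂ, ((Real.pi * t) ^ n)⁻¹ * Real.exp (-sqNorm u / t)
      = ((Real.pi * t) ^ n)⁻¹ * Real.exp (-(1 / t) * sqNorm u) := by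
    intro u; congr 2; ring
  rw [gauss, withDensity_apply _ .univ, setLIntegral_univ]
  simp_rw [h2]
  rw [← ofReal_integral_eq_lintegral_ofReal h1 (.of_forall fun u => by positivity),
    integral_const_mul, integral_exp_sqNorm hb, ← inv_pow, ← mul_pow]
  have : (Real.pi * t)⁻¹ * (Real.pi / (1 / t)) = 1 := by
    field_simp
  rw [this, one_pow, ENNReal.ofReal_one]

lemma herm_real_smul_right (κ : ℝ) (w y : Fin n → ℂ) : herm w (κ • y) = κ * herm w y := by
  simp only [herm, Finset.mul_sum, Pi.smul_apply, Complex.real_smul, map_mul, Complex.conj_ofReal]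
  exact Finset.sum_congr rfl fun i _ => by ring

lemma sqNorm_real_smul (κ : ℝ) (y : Fin n → ℂ) : sqNorm (κ • y) = κ ^ 2 * sqNorm y := by
  simp only [sqNorm, Finset.mul_sum, Pi.smul_apply, norm_smul, mul_pow, Real.norm_eq_abs, sq_abs]

/-- If all Gaussian averages of width `t` of the translates of a bounded function vanish, so do
its Gaussian averages around `0` of any larger width. -/
lemma integral_exp_mul_eq_zero_of_lt (ht : 0 < t) {b : (Fin n → ℂ) → ℂ} (hb : Continuous b)
    {M : ℝ} (hM : ∀ z, ‖b z‖ ≤ M) (h : ∀ w, ∫ z, b (w + z) ∂(gauss n t) = 0)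
    {c : ℝ} (hc : 0 < c) :
    ∫ y, (Real.exp (-(c / (1 + c * t)) * sqNorm y) : ℂ) * b y = 0 := by
  have ht1 : 0 < 1 / t := by positivity
  have hS := continuous_sqNorm (n := n)
  have h0 : ∀ w, ∫ y, (Real.exp (-(1 / t) * sqNorm (y - w)) : ℂ) * b y = 0 := by
    intro w
    have := h w
    rw [integral_gauss ht, ← integral_sub_right_eq_self _ w] at this
    have hC : (((Real.pi * t) ^ n)⁻¹ : ℂ) ≠ 0 := by
      have : 0 < Real.pi * t := by positivity
      exact_mod_cast (inv_pos.2 (pow_pos this n)).ne'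
    refine (mul_eq_zero.1 (Eq.trans ?_ this)).resolve_left hC
    rw [← integral_const_mul]
    refine integral_congr_ae (.of_forall fun y => ?_)
    have : -(1 / t) * sqNorm (y - w) = -sqNorm (y - w) / t := by ring
    simp only [this, add_sub_cancel]
    push_cast
    ring
  -- The vanishing averages around `w` are integrated against `exp(-c|w|²)`. By Fubini the weight on
  -- `b` becomes a convolution of two Gaussians, again a Gaussian.
  have hint := ((integrable_exp_sqNorm (n := n) hc).convolution_integrand
    (ContinuousLinearMap.mul ℝ ℝ) (integrable_exp_sqNorm (n := n) ht1)).ofReal (𝕜 := ℂ)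
  have hF := hint.mul_bdd (g := fun q : (Fin n → ℂ) × (Fin n → ℂ) => b q.1) (c := M)
    (hb.comp continuous_fst).aestronglyMeasurable (.of_forall fun q => hM q.1)
  have hswap := integral_integral_swap (f := fun y w =>
    ((ContinuousLinearMap.mul ℝ ℝ (Real.exp (-c * sqNorm w))
      (Real.exp (-(1 / t) * sqNorm (y - w))) : ℝ) : ℂ) * b y) hF
  simp only [ContinuousLinearMap.mul_apply', Complex.ofReal_mul] at hswap
  have hR : ∀ w, ∫ y, (Real.exp (-c * sqNorm w) : ℂ) *
      (Real.exp (-(1 / t) * sqNorm (y - w)) : ℂ) * b y = 0 := fun w => by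
    simp_rw [mul_assoc]
    rw [integral_const_mul, h0, mul_zero]
  simp only [hR, integral_zero] at hswap
  have hct : 0 < 1 + c * t := by positivity
  have hd : 0 < c + 1 / t := by positivity
  have hL : ∀ y, ∫ w, (Real.exp (-c * sqNorm w) : ℂ) *
      (Real.exp (-(1 / t) * sqNorm (y - w)) : ℂ) * b y =
      (((Real.pi / (c + 1 / t)) ^ n : ℝ) : ℂ) *
        ((Real.exp (-(c / (1 + c * t)) * sqNorm y) : ℂ) * b y) := by
    intro y
    -- Completing the square in `w`: the centre is `y / (1 + ct)` and the remaining rate in `y` is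
    -- `c / (1 + ct)`.
    have e : ∀ w, (Real.exp (-c * sqNorm w) : ℂ) *
        (Real.exp (-(1 / t) * sqNorm (y - w)) : ℂ) * b y =
        ((Real.exp (-(c + 1 / t) * sqNorm (w - (1 / (1 + c * t)) • y)) : ℝ) : ℂ) *
        ((Real.exp (-(c / (1 + c * t)) * sqNorm y) : ℂ) * b y) := by
      intro w
      rw [← mul_assoc, ← Complex.ofReal_mul, ← Complex.ofReal_mul, ← Real.exp_add, ← Real.exp_add]
      congr 3
      have h1 := congrArg Complex.re (herm_conj w y)
      rw [Complex.conj_re] at h1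
      rw [sqNorm_sub, sqNorm_sub, herm_real_smul_right, sqNorm_real_smul, Complex.re_ofReal_mul,
        h1]
      field_simp
      ring
    simp_rw [e]
    rw [integral_mul_const, integral_complex_ofReal,
      integral_sub_right_eq_self (fun w : Fin n → ℂ => Real.exp (-(c + 1 / t) * sqNorm w)),
      integral_exp_sqNorm hd]
  simp only [hL] at hswap
  rw [integral_const_mul] at hswap
  refine (mul_eq_zero.1 hswap).resolve_left ?_
  have : 0 < (Real.pi / (c + 1 / t)) ^ n := by positivity
  exact_mod_cast this.ne'

lemma norm_cexp_mul_sqNorm (a : ℂ) (z : Fin n → ℂ) :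
    ‖cexp (-a * sqNorm z)‖ = Real.exp (-a.re * sqNorm z) := by
  rw [Complex.norm_exp]; simp

/-- The Gaussian averages of a bounded function depend holomorphically on the inverse width. -/
lemma differentiableOn_integral_cexp_mul {b : (Fin n → ℂ) → ℂ} (hb : Continuous b)
    {M : ℝ} (hM : ∀ z, ‖b z‖ ≤ M) :
    DifferentiableOn ℂ (fun a : ℂ => ∫ y, cexp (-a * sqNorm y) * b y) {a | 0 < a.re} := by
  intro a₀ ha₀
  have ha₀' : 0 < a₀.re := ha₀
  have hS := continuous_sqNorm (n := n)
  have hM0 : 0 ≤ M := (norm_nonneg _).trans (hM 0)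
  have hmeas : ∀ a : ℂ, AEStronglyMeasurable (fun y : Fin n → ℂ => cexp (-a * sqNorm y) * b y) :=
    fun a => Continuous.aestronglyMeasurable (by fun_prop)
  refine (hasDerivAt_integral_of_dominated_loc_of_deriv_le
    (F := fun (a : ℂ) y => cexp (-a * sqNorm y) * b y)
    (F' := fun a y => cexp (-a * sqNorm y) * (-1 * sqNorm y) * b y)
    (bound := fun y => (4 / a₀.re * M) * Real.exp (-(a₀.re / 4) * sqNorm y))
    (s := {a | a₀.re / 2 < a.re})
    ((isOpen_lt continuous_const Complex.continuous_re).mem_nhds (by simpa using ha₀'))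
    (.of_forall hmeas) ?_ (Continuous.aestronglyMeasurable (by fun_prop))
    (.of_forall fun y a ha => ?_) ((integrable_exp_sqNorm (by positivity)).const_mul _)
    (.of_forall fun y a _ => ?_)).2.differentiableAt.differentiableWithinAt
  · refine ((integrable_exp_sqNorm ha₀').const_mul M).mono' (hmeas _) (.of_forall fun y => ?_)
    rw [norm_mul, norm_cexp_mul_sqNorm, mul_comm]
    gcongr
    exact hM y
  · have hy := sqNorm_nonneg y
    have ha' : a₀.re / 2 < a.re := ha
    rw [norm_mul, norm_mul, norm_cexp_mul_sqNorm]
    have e1 : ‖(-1 * sqNorm y : ℂ)‖ = sqNorm y := by simp [abs_of_nonneg hy]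
    -- The factor `|y|²` produced by differentiation costs half of the decay rate `a₀.re / 2`
    -- available near `a₀`; the rate `a₀.re / 4` remains.
    have e2 : sqNorm y ≤ 4 / a₀.re * Real.exp (a₀.re / 4 * sqNorm y) := by
      have := Real.add_one_le_exp (a₀.re / 4 * sqNorm y)
      calc sqNorm y = 4 / a₀.re * (a₀.re / 4 * sqNorm y) := by field_simp
        _ ≤ _ := by gcongr; linarith
    have e3 : Real.exp (-a.re * sqNorm y) ≤ Real.exp (-(a₀.re / 2) * sqNorm y) := by
      gcongr
    rw [e1]
    calc Real.exp (-a.re * sqNorm y) * sqNorm y * ‖b y‖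
        ≤ Real.exp (-(a₀.re / 2) * sqNorm y) * (4 / a₀.re * Real.exp (a₀.re / 4 * sqNorm y)) * M := by
          gcongr
          exact hM y
      _ = (4 / a₀.re * M) * (Real.exp (-(a₀.re / 2) * sqNorm y)
          * Real.exp (a₀.re / 4 * sqNorm y)) := by ring
      _ = _ := by
          rw [← Real.exp_add]
          congr 2
          ring
  · have h1 : HasDerivAt (fun a : ℂ => -a * sqNorm y) (-1 * sqNorm y) a :=
      ((hasDerivAt_id a).neg).mul_const _
    exact h1.cexp.mul_const _

/-- Averages around `0` of larger width vanish by a further Gaussian convolution. Holomorphy in the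
inverse width carries this over to all widths, and letting the width tend to zero concentrates the
average at `b 0`. -/
lemma eq_zero_of_gauss_average_eq_zero (ht : 0 < t) {b : (Fin n → ℂ) → ℂ} (hb : Continuous b)
    {M : ℝ} (hM : ∀ z, ‖b z‖ ≤ M) (h : ∀ w, ∫ z, b (w + z) ∂(gauss n t) = 0) : b 0 = 0 := by
  have hS := continuous_sqNorm (n := n)
  set H : ℂ → ℂ := fun a => ∫ y, cexp (-a * sqNorm y) * b y with hH
  have hopen : IsOpen {a : ℂ | 0 < a.re} := isOpen_lt continuous_const Complex.continuous_re
  have hconv : IsPreconnected {a : ℂ | 0 < a.re} :=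
    (convex_halfSpace_re_gt 0).isPreconnected
  have hsmall : ∀ a : ℝ, 0 < a → a < 1 / t → H a = 0 := by
    intro a ha hat
    have h1 : 0 < 1 - a * t := by
      rw [lt_div_iff₀ ht] at hat
      linarith
    -- This `c` solves `c / (1 + ct) = a`; it is positive precisely for `0 < a < 1/t`.
    have := integral_exp_mul_eq_zero_of_lt ht hb hM h (c := a / (1 - a * t)) (by positivity)
    have e : a / (1 - a * t) / (1 + a / (1 - a * t) * t) = a := by
      field_simp
      ring
    rw [e] at this
    rw [← this, hH]
    simp
  have hall : ∀ a : ℝ, 0 < a → H a = 0 := by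
    intro a ha
    have hz : (((1 / (2 * t) : ℝ)) : ℂ) ∈ {a : ℂ | 0 < a.re} := by
      simp only [Set.mem_ofPred_eq, Complex.ofReal_re]; positivity
    -- Identity theorem on the right half-plane, with accumulation point `1/(2t)` in the middle of
    -- the interval of known zeros.
    refine ((differentiableOn_integral_cexp_mul hb hM).analyticOnNhd
      hopen).eqOn_zero_of_preconnected_of_frequently_eq_zero hconv hz ?_
      (show (a : ℂ) ∈ {a : ℂ | 0 < a.re} by simpa using ha)
    have hcont : Filter.Tendsto (fun x : ℝ => (x : ℂ)) (nhdsWithin (1 / (2 * t)) {1 / (2 * t)}ᶜ)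
        (nhdsWithin ((1 / (2 * t) : ℝ) : ℂ) {((1 / (2 * t) : ℝ) : ℂ)}ᶜ) := by
      refine tendsto_nhdsWithin_iff.2 ⟨(Complex.continuous_ofReal.tendsto _).mono_left
        nhdsWithin_le_nhds, ?_⟩
      filter_upwards [self_mem_nhdsWithin] with x hx
      simpa only [Set.mem_compl_iff, Set.mem_singleton_iff, Complex.ofReal_inj] using hx
    refine hcont.frequently (Filter.Eventually.frequently ?_)
    have : Set.Ioo 0 (1 / t) ∈ nhds (1 / (2 * t)) := by
      refine Ioo_mem_nhds (by positivity) ?_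
      gcongr
      linarith
    filter_upwards [nhdsWithin_le_nhds this] with x hx
    exact hsmall x hx.1 hx.2
  -- Inverse width `(k+1)²`, rescaled so that the Gaussian is fixed and the argument of `b` shrinks
  -- to `0`.
  have hscale : ∀ k : ℕ, ∫ y, (Real.exp (-1 * sqNorm y) : ℂ) * b ((1 / (k + 1 : ℝ)) • y) = 0 := by
    intro k
    have := hall ((k + 1 : ℝ) ^ 2) (by positivity)
    have e := Measure.integral_comp_smul (volume : Measure (Fin n → ℂ))
      (fun y => cexp (-(((k + 1 : ℝ) ^ 2 : ℝ) : ℂ) * sqNorm y) * b y) (1 / (k + 1 : ℝ))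
    rw [hH] at this
    simp only at this
    rw [this, smul_zero] at e
    rw [← e]
    refine integral_congr_ae (.of_forall fun y => ?_)
    simp only [sqNorm_real_smul]
    push_cast
    congr 2
    have : ((k : ℂ) + 1) ≠ 0 := by exact_mod_cast k.succ_ne_zero
    field_simp
  have hlim : Filter.Tendsto (fun k : ℕ => ∫ y : Fin n → ℂ,
      (Real.exp (-1 * sqNorm y) : ℂ) * b ((1 / (k + 1 : ℝ)) • y)) Filter.atTop
      (nhds (∫ y : Fin n → ℂ, (Real.exp (-1 * sqNorm y) : ℂ) * b 0)) := by
    refine tendsto_integral_of_dominated_convergence (fun y => M * Real.exp (-1 * sqNorm y))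
      (fun k => Continuous.aestronglyMeasurable (by fun_prop))
      ((integrable_exp_sqNorm one_pos).const_mul M) (fun k => .of_forall fun y => ?_)
      (.of_forall fun y => ?_)
    · rw [norm_mul, Complex.norm_real, Real.norm_of_nonneg (Real.exp_pos _).le, mul_comm]
      gcongr
      exact hM _
    · refine Filter.Tendsto.const_mul _ ((hb.tendsto 0).comp ?_)
      have := (tendsto_one_div_add_atTop_nhds_zero_nat (𝕜 := ℝ)).smul_const y
      simpa using this
  simp only [hscale] at hlim
  have h0 := tendsto_nhds_unique hlim tendsto_const_nhds
  rw [integral_mul_const, integral_complex_ofReal, integral_exp_sqNorm one_pos] at h0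
  refine (mul_eq_zero.1 h0).resolve_left ?_
  have : 0 < (Real.pi / 1) ^ n := by positivity
  exact_mod_cast this.ne'

/-- A closed subspace that contains all Gaussian averages of the translates of a bounded
continuous vector-valued function contains its values. -/
lemma mem_of_gauss_average_mem {E : Type*} [NormedAddCommGroup E] [NormedSpace ℂ E]
    [CompleteSpace E] (ht : 0 < t) {N : Submodule ℂ E} (hN : IsClosed (N : Set E))
    {u : (Fin n → ℂ) → E} (hu : Continuous u) {M : ℝ} (hM : ∀ z, ‖u z‖ ≤ M)
    (h : ∀ w, ∫ z, u (w + z) ∂(gauss n t) ∈ N) : u 0 ∈ N := by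
  have := isProbabilityMeasure_gauss (n := n) ht
  by_contra hx
  obtain ⟨f, hf⟩ : ∃ f : E →L[ℂ] ℂ, f (u 0) ≠ 0 ∧ ∀ x ∈ N, f x = 0 := by
    have : IsClosed (N : Set E) := hN
    -- Since `N` is closed, `E ⧸ N` is a normed space; a functional nonzero at the class of `u 0`
    -- pulls back to one that annihilates `N`.
    obtain ⟨g, hg⟩ := SeparatingDual.exists_ne_zero (R := ℂ) (x := N.mkQ (u 0))
      (by simpa using hx)
    refine ⟨g ∘L N.mkQL, hg, fun x hx => ?_⟩
    have : N.mkQ x = 0 := by simpa using hx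
    simp [this]
  refine hf.1 (eq_zero_of_gauss_average_eq_zero ht (f.continuous.comp hu) (M := ‖f‖ * M)
    (fun z => (f.le_opNorm _).trans (by gcongr; exact hM z)) fun w => ?_)
  have hint : Integrable (fun z => u (w + z)) (gauss n t) :=
    .of_bound (Continuous.aestronglyMeasurable (by fun_prop)) M (.of_forall fun z => hM _)
  simp only [Function.comp_apply]
  rw [f.integral_comp_comm hint]
  exact hf.2 _ (h w)

/-! ### Point evaluations and the Berezin transform of a Toeplitz operator. -/

/-- Jensen's inequality for a finite weight. -/
lemma rpow_lintegral_mul_le {α : Type*} [MeasurableSpace α] {μ : Measure α} {q : ℝ} (hq : 1 ≤ q)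
    {K H : α → ℝ≥0∞} (hK : Measurable K) (hKfin : ∫⁻ w, K w ∂μ ≠ ∞) (hH : AEMeasurable H μ) :
    (∫⁻ w, K w * H w ∂μ) ^ q ≤ (∫⁻ w, K w ∂μ) ^ (q - 1) * ∫⁻ w, K w * H w ^ q ∂μ := by
  have hq0 : 0 < q := by linarith
  set ν : Measure α := μ.withDensity K with hν
  have hac : ν ≪ μ := withDensity_absolutelyContinuous _ _
  have hfin : ∀ᵐ w ∂μ, K w < ∞ := ae_lt_top hK hKfin
  have e1 : ∀ G : α → ℝ≥0∞, ∫⁻ w, G w ∂ν = ∫⁻ w, K w * G w ∂μ := fun G => by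
    rw [hν, lintegral_withDensity_eq_lintegral_mul_non_measurable _ hK hfin]; rfl
  have e2 : ν Set.univ = ∫⁻ w, K w ∂μ := by
    rw [hν, withDensity_apply _ .univ, setLIntegral_univ]
  have := eLpNorm'_le_eLpNorm'_mul_rpow_measure_univ (μ := ν) (f := H) one_pos hq
    ((hH.mono_ac hac).aestronglyMeasurable)
  simp only [eLpNorm'_eq_lintegral_enorm, enorm_eq_self, ENNReal.rpow_one, e1, e2, one_div,
    inv_one] at this
  calc _ ≤ ((∫⁻ w, K w * H w ^ q ∂μ) ^ q⁻¹ * (∫⁻ w, K w ∂μ) ^ (1 - q⁻¹)) ^ q := by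
        gcongr
    _ = _ := by
        rw [ENNReal.mul_rpow_of_nonneg _ _ hq0.le, ← ENNReal.rpow_mul, ← ENNReal.rpow_mul,
          inv_mul_cancel₀ hq0.ne', ENNReal.rpow_one, mul_comm,
          show (1 - q⁻¹) * q = q - 1 by field_simp]

/-- Splitting `exp(-|w|²/t)` into two equal weights and adding the weight at `z` completes the
square in the kernel, so in weighted form `P_t` is dominated by convolution with an integrable
Gaussian. -/
lemma enorm_bargmann_mul_weight_le (ht : 0 < t) (h : (Fin n → ℂ) → ℂ) (z : Fin n → ℂ) :
    ‖bargmann t h z‖ₑ * ENNReal.ofReal (Real.exp (-sqNorm z / (2 * t)))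
      ≤ ∫⁻ w, ENNReal.ofReal (((Real.pi * t) ^ n)⁻¹ * Real.exp (-sqNorm (z - w) / (2 * t)))
        * (‖h w‖ₑ * ENNReal.ofReal (Real.exp (-sqNorm w / (2 * t)))) := by
  unfold bargmann
  rw [integral_gauss ht]
  refine (mul_le_mul_left (enorm_integral_le_lintegral_enorm _) _).trans ?_
  rw [← lintegral_mul_const' _ _ ENNReal.ofReal_ne_top]
  refine lintegral_mono fun w => le_of_eq ?_
  have e : ((Real.pi * t) ^ n)⁻¹ * Real.exp (-sqNorm w / t) * Real.exp (herm z w / t).re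
        * Real.exp (-sqNorm z / (2 * t))
      = ((Real.pi * t) ^ n)⁻¹ * Real.exp (-sqNorm (z - w) / (2 * t))
        * Real.exp (-sqNorm w / (2 * t)) := by
    simp only [mul_assoc, ← Real.exp_add]
    congr 2
    rw [sqNorm_sub, Complex.div_ofReal_re]
    field_simp
    ring
  have e' := congrArg ENNReal.ofReal e
  rw [ENNReal.ofReal_mul (q := Real.exp (-sqNorm z / (2 * t))) (by positivity),
    ENNReal.ofReal_mul (q := Real.exp (herm z w / t).re) (by positivity),
    ENNReal.ofReal_mul (q := Real.exp (-sqNorm w / (2 * t))) (by positivity)] at e'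
  simp only [enorm_mul]
  rw [← ofReal_norm (Complex.ofReal _), ← ofReal_norm (cexp _), Complex.norm_exp,
    Complex.norm_real, Real.norm_of_nonneg (by positivity), mul_left_comm _ ‖h w‖ₑ, ← e']
  ring

/-- The weighted values of `P_t h` are bounded by the `L^p(μ_{2t/p})` norm of `h`. -/
lemma exists_norm_bargmann_le (n : ℕ) (ht : 0 < t) (hp : 1 ≤ p) (hp' : p ≠ ∞) :
    ∃ C : ℝ, 0 ≤ C ∧ ∀ h : (Fin n → ℂ) → ℂ, MemLp h p (gauss n (2 * t / p.toReal)) → ∀ z,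
      ‖bargmann t h z‖ * Real.exp (-sqNorm z / (2 * t))
        ≤ C * (eLpNorm h p (gauss n (2 * t / p.toReal))).toReal := by
  have hq := one_le_toReal hp hp'
  set q := p.toReal with hqdef
  have hq0 : 0 < q := by linarith
  have hp0 : p ≠ 0 := (zero_lt_one.trans_le hp).ne'
  have hS := continuous_sqNorm (n := n)
  -- The factors are the mass `2 ^ n` of the kernel, to the power left by Jensen, the maximum of the
  -- kernel, and the constant of `lintegral_weight` inverted.
  set A : ℝ≥0∞ := ENNReal.ofReal (2 ^ n) ^ (q - 1) * ENNReal.ofReal ((Real.pi * t) ^ n)⁻¹ *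
    (ENNReal.ofReal ((Real.pi * (2 * t / q)) ^ n)⁻¹)⁻¹ with hA
  have hc0 : ENNReal.ofReal ((Real.pi * (2 * t / q)) ^ n)⁻¹ ≠ 0 := by
    have : 0 < ((Real.pi * (2 * t / q)) ^ n)⁻¹ := by positivity
    simpa using this
  have hAtop : A ≠ ∞ := ENNReal.mul_ne_top (ENNReal.mul_ne_top
    (ENNReal.rpow_ne_top_of_nonneg (by linarith) ENNReal.ofReal_ne_top) ENNReal.ofReal_ne_top)
    (ENNReal.inv_ne_top.2 hc0)
  refine ⟨(A ^ (1 / q)).toReal, ENNReal.toReal_nonneg, fun h hh z => ?_⟩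
  have hm : AEStronglyMeasurable h volume := hh.1.mono_ac (ac_gauss (by positivity))
  set H : (Fin n → ℂ) → ℝ≥0∞ := fun w =>
    ‖h w‖ₑ * ENNReal.ofReal (Real.exp (-sqNorm w / (2 * t))) with hH
  have hHm : AEMeasurable H := hm.enorm.mul
    (Measurable.ennreal_ofReal (by fun_prop)).aemeasurable
  set K : (Fin n → ℂ) → ℝ≥0∞ := fun u =>
    ENNReal.ofReal (((Real.pi * t) ^ n)⁻¹ * Real.exp (-sqNorm u / (2 * t))) with hKdef
  have hKm : Measurable fun w => K (z - w) :=
    Measurable.ennreal_ofReal (by fun_prop)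
  have hK1 : ∫⁻ w, K (z - w) = ENNReal.ofReal (2 ^ n) := by
    rw [lintegral_sub_left_eq_self K z, hKdef, lintegral_kernel ht]
  have key : (∫⁻ w, K (z - w) * H w) ^ q ≤
      A * ∫⁻ z, ‖h z‖ₑ ^ q ∂(gauss n (2 * t / q)) := by
    refine (rpow_lintegral_mul_le hq hKm (by rw [hK1]; exact ENNReal.ofReal_ne_top) hHm).trans ?_
    rw [hK1, lintegral_weight ht hq, hA, mul_assoc, mul_assoc, ← mul_assoc _⁻¹,
      ENNReal.inv_mul_cancel hc0 ENNReal.ofReal_ne_top, one_mul,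
      ← lintegral_const_mul' _ _ ENNReal.ofReal_ne_top]
    refine mul_le_mul_right (lintegral_mono fun w => mul_le_mul_left ?_ _) _
    refine ENNReal.ofReal_le_ofReal (mul_le_of_le_one_right (by positivity) ?_)
    rw [Real.exp_le_one_iff]
    exact div_nonpos_of_nonpos_of_nonneg (neg_nonpos.2 (sqNorm_nonneg _)) (by positivity)
  have key2 : ‖bargmann t h z‖ₑ * ENNReal.ofReal (Real.exp (-sqNorm z / (2 * t))) ≤
      A ^ (1 / q) * eLpNorm h p (gauss n (2 * t / q)) := by
    refine (enorm_bargmann_mul_weight_le ht h z).trans ?_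
    rw [eLpNorm_eq_lintegral_rpow_enorm_toReal hp0 hp', ← ENNReal.mul_rpow_of_nonneg _ _
      (by positivity), one_div, ENNReal.le_rpow_inv_iff hq0]
    exact key
  have hfin : A ^ (1 / q) * eLpNorm h p (gauss n (2 * t / q)) ≠ ∞ :=
    ENNReal.mul_ne_top (ENNReal.rpow_ne_top_of_nonneg (by positivity) hAtop) hh.2.ne
  have := ENNReal.toReal_mono hfin key2
  rwa [ENNReal.toReal_mul, ENNReal.toReal_mul, toReal_enorm,
    ENNReal.toReal_ofReal (Real.exp_pos _).le] at this

lemma norm_eq_eLpNorm [Fact (1 ≤ p)] (g : FockSpace n t p) :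
    ‖g‖ = (eLpNorm (toLp g) p (gauss n (2 * t / p.toReal))).toReal := rfl

/-- The element of the Fock space given by an entire function in `L^p(μ_{2t/p})`. -/
def ofEntire (g : (Fin n → ℂ) → ℂ) (hg : Differentiable ℂ g)
    (hm : MemLp g p (gauss n (2 * t / p.toReal))) : FockSpace n t p :=
  ⟨hm.toLp, g, hg, hm.coeFn_toLp⟩

lemma norm_ofEntire [Fact (1 ≤ p)] {g : (Fin n → ℂ) → ℂ} (hg : Differentiable ℂ g)
    (hm : MemLp g p (gauss n (2 * t / p.toReal))) :
    ‖(ofEntire g hg hm : FockSpace n t p)‖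
      = (eLpNorm g p (gauss n (2 * t / p.toReal))).toReal :=
  Lp.norm_toLp g hm

lemma conj_normKernelFun (z w : Fin n → ℂ) :
    conj (normKernelFun t z w)
      = cexp (-sqNorm z / (2 * t)) * cexp (herm z w / t) := by
  rw [normKernelFun, ← Complex.exp_conj, ← Complex.exp_add]
  congr 1
  simp only [map_sub, map_div₀, herm_conj, Complex.conj_ofReal, map_mul, map_ofNat]
  ring

section Evaluation

variable [ht : Fact (0 < t)] [hp : Fact (1 ≤ p)] [hp' : Fact (p ≠ ∞)]

/-- Evaluation of elements of the Fock space at a point. -/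
def ev (t : ℝ) (p : ℝ≥0∞) [ht : Fact (0 < t)] [hp : Fact (1 ≤ p)] [hp' : Fact (p ≠ ∞)]
    (z : Fin n → ℂ) : FockSpace n t p →L[ℂ] ℂ :=
  LinearMap.mkContinuous
    -- Evaluating through `P_t` picks out the entire representative by the reproducing property, so
    -- none has to be chosen.
    { toFun := fun g => bargmann t (toLp g) z
      map_add' := fun f g => by
        have h := bargmann_add ht.out hp.out hp'.out (Lp.memLp (toLp f)) (Lp.memLp (toLp g))
        rw [map_add, bargmann_congr (exponent_pos ht.out hp.out hp'.out)
          (Lp.coeFn_add (toLp f) (toLp g)), h, Pi.add_apply]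
      map_smul' := fun c f => by
        rw [map_smul, bargmann_congr (exponent_pos ht.out hp.out hp'.out)
          (Lp.coeFn_smul c (toLp f)), bargmann_smul, RingHom.id_apply, Pi.smul_apply] }
    ((exists_norm_bargmann_le n ht.out hp.out hp'.out).choose * Real.exp (sqNorm z / (2 * t)))
    fun g => by
      have := (exists_norm_bargmann_le n ht.out hp.out hp'.out).choose_spec.2 _
        (Lp.memLp (toLp g)) z
      rw [neg_div, Real.exp_neg, ← div_eq_mul_inv, div_le_iff₀ (Real.exp_pos _)] at this
      rw [norm_eq_eLpNorm]
      exact this.trans_eq (by ring)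

lemma ev_apply (z : Fin n → ℂ) (g : FockSpace n t p) : ev t p z g = bargmann t (toLp g) z := rfl

lemma exists_norm_ev_le (n : ℕ) (t : ℝ) (p : ℝ≥0∞) [ht : Fact (0 < t)] [hp : Fact (1 ≤ p)]
    [hp' : Fact (p ≠ ∞)] : ∃ C : ℝ, 0 ≤ C ∧ ∀ (z : Fin n → ℂ) (g : FockSpace n t p),
      ‖ev t p z g‖ * Real.exp (-sqNorm z / (2 * t)) ≤ C * ‖g‖ := by
  obtain ⟨C, hC, h⟩ := exists_norm_bargmann_le n ht.out hp.out hp'.out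
  exact ⟨C, hC, fun z g => h _ (Lp.memLp (toLp g)) z⟩

lemma toLp_ae_eq_ev (g : FockSpace n t p) :
    toLp g =ᵐ[gauss n (2 * t / p.toReal)] fun z => ev t p z g := by
  have h := coeFn_bargmannLp (toLp g)
  rwa [show bargmannLp n t p (toLp g) = toLp g from bargmannLp_of_mem g.2] at h

lemma ext_ev {f g : FockSpace n t p} (h : ∀ z, ev t p z f = ev t p z g) : f = g := by
  refine toLp_injective (Lp.ext ((toLp_ae_eq_ev f).trans ?_))
  simp only [h]
  exact (toLp_ae_eq_ev g).symm

lemma differentiable_ev (g : FockSpace n t p) : Differentiable ℂ fun z => ev t p z g :=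
  differentiable_bargmann ht.out hp.out hp'.out (Lp.memLp (toLp g))

lemma memLp_ev (g : FockSpace n t p) :
    MemLp (fun z => ev t p z g) p (gauss n (2 * t / p.toReal)) :=
  (memLp_congr_ae (toLp_ae_eq_ev g)).1 (Lp.memLp (toLp g))

lemma ev_ofEntire {g : (Fin n → ℂ) → ℂ} (hg : Differentiable ℂ g)
    (hm : MemLp g p (gauss n (2 * t / p.toReal))) (z : Fin n → ℂ) :
    ev t p z (ofEntire g hg hm) = g z := by
  have h : bargmann t (toLp (ofEntire g hg hm)) = bargmann t g :=
    bargmann_congr (exponent_pos ht.out hp.out hp'.out) hm.coeFn_toLp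
  rw [ev_apply, h, bargmann_eq_self ht.out hp.out hp'.out hg hm]

lemma norm_eq_eLpNorm_ev (g : FockSpace n t p) :
    ‖g‖ = (eLpNorm (fun z => ev t p z g) p (gauss n (2 * t / p.toReal))).toReal := by
  rw [norm_eq_eLpNorm, eLpNorm_congr_ae (toLp_ae_eq_ev g)]

lemma ev_normKernel (z w : Fin n → ℂ) : ev t p w (normKernel t p z) = normKernelFun t z w :=
  ev_ofEntire (differentiable_normKernelFun t z) (memLp_normKernelFun ht.out hp.out hp'.out z) w

lemma ev_toeplitz (f : (Fin n → ℂ) →ᵇ ℂ) (g : FockSpace n t p) (z : Fin n → ℂ) :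
    ev t p z (toeplitz t p f g) = ∫ w, cexp (herm z w / t) * (f w * ev t p w g) ∂(gauss n t) := by
  have h := coeFn_toeplitz f g
  have h2 : bargmann t (toLp (toeplitz t p f g)) = bargmann t (fun w => f w * toLp g w) := by
    have hm := memLp_bcf_mul f (Lp.memLp (toLp g))
    rw [bargmann_congr (exponent_pos ht.out hp.out hp'.out) h]
    exact bargmann_eq_self ht.out hp.out hp'.out (differentiable_bargmann ht.out hp.out hp'.out hm)
      (memLp_bargmann ht.out hp.out hp'.out hm)
  have h3 : bargmann t (fun w => f w * toLp g w) = bargmann t fun w => f w * ev t p w g :=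
    bargmann_congr (exponent_pos ht.out hp.out hp'.out) (by
      filter_upwards [toLp_ae_eq_ev g] with w hw
      rw [hw])
  rw [ev_apply, h2, h3]
  rfl

lemma berezin_eq (A : FockSpace n t p →L[ℂ] FockSpace n t p) (z : Fin n → ℂ) :
    berezin A z = cexp (-sqNorm z / (2 * t)) * ev t p z (A (normKernel t p z)) := by
  rw [ev_apply, bargmann, berezin, ← integral_const_mul]
  refine integral_congr_ae (.of_forall fun w => ?_)
  simp only [conj_normKernelFun]
  ring

/-- The measure `|k_z|² dμ_t` is `μ_t` translated to the centre `z`. -/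
lemma berezin_toeplitz (f : (Fin n → ℂ) →ᵇ ℂ) (z : Fin n → ℂ) :
    berezin (toeplitz t p f) z = ∫ u, f (z - u) ∂(gauss n t) := by
  have ht0 := ht.out
  rw [berezin_eq, ev_toeplitz, integral_gauss ht0, integral_gauss ht0,
    ← integral_sub_left_eq_self _ volume z, ← integral_const_mul]
  refine integral_congr_ae (.of_forall fun w => ?_)
  simp only [ev_normKernel, normKernelFun]
  have e : cexp (-sqNorm z / (2 * t)) * (cexp (-sqNorm (z - w) / t) *
      (cexp (herm z (z - w) / t) * cexp (herm (z - w) z / t - sqNorm z / (2 * t))))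
      = cexp (-sqNorm w / t) := by
    rw [← Complex.exp_add, ← Complex.exp_add, ← Complex.exp_add]
    congr 1
    have htc : (t : ℂ) ≠ 0 := by exact_mod_cast ht0.ne'
    simp only [sqNorm_eq_herm, sub_eq_add_neg, herm_add_left, herm_add_right]
    have h1 : ∀ x y : Fin n → ℂ, herm x (-y) = -herm x y := fun x y => by simp [herm]
    have h2 : ∀ x y : Fin n → ℂ, herm (-x) y = -herm x y := fun x y => by simp [herm]
    simp only [h1, h2]
    field_simp
    ring
  push_cast
  linear_combination ((Real.pi * t : ℂ) ^ n)⁻¹ * f (z - w) * e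

end Evaluation

/-! ### Weyl operators and the shift action. -/

lemma herm_neg_left (x y : Fin n → ℂ) : herm (-x) y = -herm x y := by simp [herm]

lemma herm_neg_right (x y : Fin n → ℂ) : herm x (-y) = -herm x y := by simp [herm]

lemma norm_normKernelFun_mul_exp (ht : 0 < t) (u w : Fin n → ℂ) :
    ‖normKernelFun t u w‖ * Real.exp (-sqNorm w / (2 * t))
      = Real.exp (-sqNorm (w - u) / (2 * t)) := by
  have e : (herm w u / t - sqNorm u / (2 * t) : ℂ).re
      = (herm w u).re / t - sqNorm u / (2 * t) := by
    have : (sqNorm u / (2 * t) : ℂ) = ((sqNorm u / (2 * t) : ℝ) : ℂ) := by push_cast; rfl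
    rw [this, Complex.sub_re, Complex.div_ofReal_re, Complex.ofReal_re]
  rw [normKernelFun, Complex.norm_exp, ← Real.exp_add, e, sqNorm_sub]
  congr 1
  field_simp
  ring

lemma enorm_normKernelFun_mul (ht : 0 < t) (u w : Fin n → ℂ) (x : ℂ) :
    ‖normKernelFun t u w * x‖ₑ * ENNReal.ofReal (Real.exp (-sqNorm w / (2 * t)))
      = ‖x‖ₑ * ENNReal.ofReal (Real.exp (-sqNorm (w - u) / (2 * t))) := by
  rw [← norm_normKernelFun_mul_exp ht u w, ENNReal.ofReal_mul (norm_nonneg _), enorm_mul,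
    ofReal_norm]
  ring

/-- The factor `k_u` turns the weight `exp(-|w|²/(2t))` into its translate by `u`, so the claim is
translation invariance of Lebesgue measure, with the same `k_u` for every `p`. -/
lemma eLpNorm_weyl (ht : 0 < t) (hp : 1 ≤ p) (hp' : p ≠ ∞) (u : Fin n → ℂ)
    (g : (Fin n → ℂ) → ℂ) :
    eLpNorm (fun w => normKernelFun t u w * g (w - u)) p (gauss n (2 * t / p.toReal))
      = eLpNorm g p (gauss n (2 * t / p.toReal)) := by
  have hp0 : p ≠ 0 := (zero_lt_one.trans_le hp).ne'
  rw [eLpNorm_eq_lintegral_rpow_enorm_toReal hp0 hp', eLpNorm_eq_lintegral_rpow_enorm_toReal hp0 hp',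
    lintegral_weight ht (one_le_toReal hp hp'), lintegral_weight ht (one_le_toReal hp hp')]
  simp_rw [enorm_normKernelFun_mul ht]
  rw [lintegral_sub_right_eq_self (fun w =>
    (‖g w‖ₑ * ENNReal.ofReal (Real.exp (-sqNorm w / (2 * t)))) ^ p.toReal) u]

lemma normKernelFun_mul_neg (t : ℝ) (u w : Fin n → ℂ) :
    normKernelFun t u w * normKernelFun t (-u) (w - u) = 1 := by
  rw [normKernelFun, normKernelFun, ← Complex.exp_add, ← Complex.exp_zero]
  congr 1
  simp only [sqNorm_eq_herm, sub_eq_add_neg, herm_add_left, herm_neg_left, herm_neg_right]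
  ring

section Weyl

variable [ht : Fact (0 < t)] [hp : Fact (1 ≤ p)] [hp' : Fact (p ≠ ∞)]

lemma memLp_weyl (u : Fin n → ℂ) (g : FockSpace n t p) :
    MemLp (fun w => normKernelFun t u w * ev t p (w - u) g) p (gauss n (2 * t / p.toReal)) := by
  refine ⟨Continuous.aestronglyMeasurable ?_, ?_⟩
  · exact (differentiable_normKernelFun t u).continuous.mul
      ((differentiable_ev g).continuous.comp (by fun_prop))
  · rw [eLpNorm_weyl ht.out hp.out hp'.out u fun w => ev t p w g]
    exact (memLp_ev g).2

lemma differentiable_weyl (u : Fin n → ℂ) (g : FockSpace n t p) :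
    Differentiable ℂ fun w => normKernelFun t u w * ev t p (w - u) g :=
  (differentiable_normKernelFun t u).mul ((differentiable_ev g).comp (by fun_prop))

/-- The Weyl operator `W_u g(w) = k_u(w) g(w - u)`. -/
def weyl (t : ℝ) (p : ℝ≥0∞) [ht : Fact (0 < t)] [hp : Fact (1 ≤ p)] [hp' : Fact (p ≠ ∞)]
    (u : Fin n → ℂ) : FockSpace n t p →L[ℂ] FockSpace n t p :=
  LinearMap.mkContinuous
    { toFun := fun g => ofEntire _ (differentiable_weyl u g) (memLp_weyl u g)
      map_add' := fun f g => ext_ev fun z => by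
        simp only [map_add, ev_ofEntire, mul_add]
      map_smul' := fun c f => ext_ev fun z => by
        simp only [map_smul, ev_ofEntire, RingHom.id_apply, smul_eq_mul, mul_left_comm] }
    1 fun g => by
      simp only [LinearMap.coe_mk, AddHom.coe_mk, one_mul]
      rw [norm_ofEntire, eLpNorm_weyl ht.out hp.out hp'.out u fun w => ev t p w g,
        ← norm_eq_eLpNorm_ev]

lemma ev_weyl (u w : Fin n → ℂ) (g : FockSpace n t p) :
    ev t p w (weyl t p u g) = normKernelFun t u w * ev t p (w - u) g :=
  ev_ofEntire (differentiable_weyl u g) (memLp_weyl u g) w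

lemma norm_weyl_apply_le (u : Fin n → ℂ) (g : FockSpace n t p) : ‖weyl t p u g‖ ≤ ‖g‖ := by
  simpa using (weyl t p u).le_of_opNorm_le (LinearMap.mkContinuous_norm_le _ zero_le_one _) g

lemma weyl_neg_apply (u : Fin n → ℂ) (g : FockSpace n t p) :
    weyl t p u (weyl t p (-u) g) = g := by
  refine ext_ev fun w => ?_
  rw [ev_weyl, ev_weyl, ← mul_assoc, normKernelFun_mul_neg, one_mul]
  simp

lemma weyl_neg_apply' (u : Fin n → ℂ) (g : FockSpace n t p) :
    weyl t p (-u) (weyl t p u g) = g := by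
  simpa using weyl_neg_apply (-u) g

lemma weyl_normKernel_zero (u : Fin n → ℂ) :
    weyl t p u (normKernel t p 0) = normKernel t p u := by
  refine ext_ev fun w => ?_
  rw [ev_weyl, ev_normKernel, ev_normKernel]
  simp [normKernelFun, herm, sqNorm]

lemma norm_normKernel_le (u : Fin n → ℂ) :
    ‖normKernel t p u‖ ≤ ‖(normKernel t p 0 : FockSpace n t p)‖ := by
  rw [← weyl_normKernel_zero]
  exact norm_weyl_apply_le _ _

/-- The action of `ℂⁿ` on operators by conjugation with Weyl operators. -/
def shift (u : Fin n → ℂ) (A : FockSpace n t p →L[ℂ] FockSpace n t p) :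
    FockSpace n t p →L[ℂ] FockSpace n t p :=
  weyl t p u ∘L A ∘L weyl t p (-u)

lemma shift_apply (u : Fin n → ℂ) (A : FockSpace n t p →L[ℂ] FockSpace n t p)
    (g : FockSpace n t p) : shift u A g = weyl t p u (A (weyl t p (-u) g)) := rfl

lemma norm_shift_le (u : Fin n → ℂ) (A : FockSpace n t p →L[ℂ] FockSpace n t p) :
    ‖shift u A‖ ≤ ‖A‖ := by
  refine ContinuousLinearMap.opNorm_le_bound _ (norm_nonneg _) fun g => ?_
  rw [shift_apply]
  refine (norm_weyl_apply_le u _).trans ((A.le_opNorm _).trans ?_)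
  gcongr
  exact norm_weyl_apply_le (-u) g

lemma shift_one (u : Fin n → ℂ) : shift u (1 : FockSpace n t p →L[ℂ] FockSpace n t p) = 1 := by
  ext1 g
  exact weyl_neg_apply u g

lemma shift_mul (u : Fin n → ℂ) (A B : FockSpace n t p →L[ℂ] FockSpace n t p) :
    shift u (A * B) = shift u A * shift u B := by
  ext1 g
  change weyl t p u (A (B _)) = weyl t p u (A (weyl t p (-u) (weyl t p u (B _))))
  rw [weyl_neg_apply']

/-- The exponent is purely imaginary. In `berezin_shift` the resulting phase cancels against the one
from the outer Weyl operator. -/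
lemma weyl_neg_normKernel (u z : Fin n → ℂ) :
    weyl t p (-u) (normKernel t p z)
      = cexp ((herm u z - herm z u) / (2 * t)) • normKernel t p (z - u) := by
  refine ext_ev fun w => ?_
  rw [ev_weyl, map_smul, ev_normKernel, ev_normKernel, smul_eq_mul, normKernelFun, normKernelFun,
    normKernelFun, ← Complex.exp_add, ← Complex.exp_add]
  congr 1
  have htc : (t : ℂ) ≠ 0 := by exact_mod_cast ht.out.ne'
  simp only [sqNorm_eq_herm, sub_eq_add_neg, herm_add_left, herm_add_right, herm_neg_left,
    herm_neg_right, neg_neg]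
  field_simp
  ring

lemma berezin_shift (u z : Fin n → ℂ) (A : FockSpace n t p →L[ℂ] FockSpace n t p) :
    berezin (shift u A) z = berezin A (z - u) := by
  rw [berezin_eq, berezin_eq, shift_apply, weyl_neg_normKernel, map_smul, map_smul, map_smul,
    ev_weyl, smul_eq_mul, ← mul_assoc, ← mul_assoc, normKernelFun, ← Complex.exp_add,
    ← Complex.exp_add]
  congr 2
  have htc : (t : ℂ) ≠ 0 := by exact_mod_cast ht.out.ne'
  simp only [sqNorm_eq_herm, sub_eq_add_neg, herm_add_left, herm_add_right, herm_neg_left,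
    herm_neg_right]
  field_simp
  ring

lemma shift_toeplitz (u : Fin n → ℂ) (f : (Fin n → ℂ) →ᵇ ℂ) :
    shift u (toeplitz t p f) = toeplitz t p (translate u f) := by
  have ht0 := ht.out
  ext1 g
  refine ext_ev fun z => ?_
  rw [shift_apply, ev_weyl, ev_toeplitz, ev_toeplitz, integral_gauss ht0, integral_gauss ht0,
    ← integral_sub_right_eq_self _ u, ← integral_const_mul]
  refine integral_congr_ae (.of_forall fun w => ?_)
  simp only [ev_weyl, normKernelFun, sub_neg_eq_add, sub_add_cancel]
  have hf : translate u f w = f (w - u) := rfl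
  have e : cexp (herm z u / t - sqNorm u / (2 * t)) * (cexp (-sqNorm (w - u) / t) *
      (cexp (herm (z - u) (w - u) / t) * cexp (herm (w - u) (-u) / t - sqNorm (-u) / (2 * t))))
      = cexp (-sqNorm w / t) * cexp (herm z w / t) := by
    simp only [← Complex.exp_add]
    congr 1
    have htc : (t : ℂ) ≠ 0 := by exact_mod_cast ht0.ne'
    simp only [sqNorm_eq_herm, sub_eq_add_neg, herm_add_left, herm_add_right, herm_neg_left,
      herm_neg_right, neg_neg]
    field_simp
    ring
  rw [hf]
  push_cast
  linear_combination ((Real.pi * t : ℂ) ^ n)⁻¹ * f (w - u) * ev t p w g * e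

/-- Uniformity in `z` has two sources: weighted point evaluations are uniformly bounded, and each
`k_z` is a Weyl translate of `k_0`. -/
lemma exists_norm_berezin_le (n : ℕ) (t : ℝ) (p : ℝ≥0∞) [ht : Fact (0 < t)] [hp : Fact (1 ≤ p)]
    [hp' : Fact (p ≠ ∞)] : ∃ C : ℝ, 0 ≤ C ∧
      ∀ (A : FockSpace n t p →L[ℂ] FockSpace n t p) z, ‖berezin A z‖ ≤ C * ‖A‖ := by
  obtain ⟨C, hC, h⟩ := exists_norm_ev_le n t p
  refine ⟨C * ‖(normKernel t p 0 : FockSpace n t p)‖, by positivity, fun A z => ?_⟩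
  have e : ‖cexp (-sqNorm z / (2 * t))‖ = Real.exp (-sqNorm z / (2 * t)) := by
    have : (-sqNorm z / (2 * t) : ℂ) = ((-sqNorm z / (2 * t) : ℝ) : ℂ) := by push_cast; rfl
    rw [this, Complex.norm_exp, Complex.ofReal_re]
  rw [berezin_eq, norm_mul, e, mul_comm]
  calc _ ≤ C * ‖A (normKernel t p z)‖ := h _ _
    _ ≤ C * (‖A‖ * ‖(normKernel t p 0 : FockSpace n t p)‖) := by
        gcongr
        exact (A.le_opNorm _).trans (by gcongr; exact norm_normKernel_le z)
    _ = _ := by ring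

/-- The Berezin transform at a point as a continuous functional. -/
def berezinCLM (t : ℝ) (p : ℝ≥0∞) [ht : Fact (0 < t)] [hp : Fact (1 ≤ p)] [hp' : Fact (p ≠ ∞)]
    (z : Fin n → ℂ) : (FockSpace n t p →L[ℂ] FockSpace n t p) →L[ℂ] ℂ :=
  cexp (-sqNorm z / (2 * t)) • ev t p z ∘L ContinuousLinearMap.apply ℂ _ (normKernel t p z)

lemma berezinCLM_apply (z : Fin n → ℂ) (A : FockSpace n t p →L[ℂ] FockSpace n t p) :
    berezinCLM t p z A = berezin A z := by
  rw [berezin_eq]; rfl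

end Weyl

/-! ### Injectivity of the Berezin transform. -/

lemma norm_herm_le_oneNorm_left (v b : Fin n → ℂ) : ‖herm v b‖ ≤ ‖b‖ * oneNorm v := by
  rw [← herm_conj b v, RCLike.norm_conj]
  exact norm_herm_le b v

lemma norm_cexp_sub_cexp_le (a b : ℂ) :
    ‖cexp a - cexp b‖ ≤ Real.exp ‖b‖ * Real.exp (2 * ‖a - b‖) * ‖a - b‖ := by
  have h1 : cexp a - cexp b = cexp b * (cexp (a - b) - 1) := by
    rw [mul_sub, ← Complex.exp_add]; simp
  have h2 : ‖cexp (a - b) - 1‖ ≤ ‖a - b‖ * Real.exp ‖a - b‖ := by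
    simpa using Complex.norm_exp_sub_sum_le_norm_mul_exp (a - b) 1
  have h3 : ‖cexp b‖ ≤ Real.exp ‖b‖ := Complex.norm_exp_le_exp_norm b
  rw [h1, norm_mul]
  calc _ ≤ Real.exp ‖b‖ * (‖a - b‖ * Real.exp ‖a - b‖) := by gcongr
    _ ≤ Real.exp ‖b‖ * (‖a - b‖ * Real.exp (2 * ‖a - b‖)) := by
        gcongr
        linarith [norm_nonneg (a - b)]
    _ = _ := by ring

lemma memLp_exp_oneNorm (ht : 0 < t) (hp : 1 ≤ p) (hp' : p ≠ ∞) (M : ℝ) :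
    MemLp (fun w : Fin n → ℂ => (Real.exp (M * oneNorm w) : ℂ)) p
      (gauss n (2 * t / p.toReal)) := by
  have hq := one_le_toReal hp hp'
  have hp0 : p ≠ 0 := (zero_lt_one.trans_le hp).ne'
  have hc := continuous_sqNorm (n := n)
  have hc1 := continuous_oneNorm (n := n)
  have hb : 0 < p.toReal / (2 * t) := by positivity
  rw [memLp_weight_iff ht hp hp', ← integrable_norm_rpow_iff
    (Continuous.aestronglyMeasurable (by fun_prop)) hp0 hp']
  refine ((integrable_exp_sqNorm (n := n) (half_pos hb)).const_mul
    (Real.exp (n * ((M * p.toReal) ^ 2 / (2 * (p.toReal / (2 * t))))))).mono'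
    (Continuous.aestronglyMeasurable ?_) (.of_forall fun w => ?_)
  · exact Continuous.rpow_const (by fun_prop) fun _ => Or.inr (by linarith)
  · refine Eq.trans_le ?_ (exp_oneNorm_le hb (M * p.toReal) w)
    rw [← Complex.ofReal_mul, ← Real.exp_add, Complex.norm_real,
      Real.norm_of_nonneg (Real.exp_pos _).le, ← Real.exp_mul,
      Real.norm_of_nonneg (Real.exp_pos _).le]
    congr 1
    field_simp
    ring

/-- An entire function that vanishes on the real axis vanishes identically. -/
lemma eq_zero_of_ofReal_eq_zero {f : ℂ → ℂ} (hf : Differentiable ℂ f)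
    (h : ∀ x : ℝ, f x = 0) (z : ℂ) : f z = 0 := by
  refine (hf.differentiableOn.analyticOnNhd
    isOpen_univ).eqOn_zero_of_preconnected_of_frequently_eq_zero isPreconnected_univ
    (Set.mem_univ ((0 : ℝ) : ℂ)) ?_ (Set.mem_univ z)
  have hcont : Filter.Tendsto (fun x : ℝ => (x : ℂ)) (nhdsWithin 0 {0}ᶜ)
      (nhdsWithin ((0 : ℝ) : ℂ) {((0 : ℝ) : ℂ)}ᶜ) := by
    refine tendsto_nhdsWithin_iff.2 ⟨(Complex.continuous_ofReal.tendsto _).mono_left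
      nhdsWithin_le_nhds, ?_⟩
    filter_upwards [self_mem_nhdsWithin] with x hx
    simpa only [Set.mem_compl_iff, Set.mem_singleton_iff, Complex.ofReal_inj] using hx
  exact hcont.frequently (Filter.Eventually.frequently (.of_forall h))

/-- From `x ^ k / k! ≤ exp x`, with the free parameter `R` absorbed into `x`. A large `R` buys
geometric decay in `k` at any desired ratio. -/
lemma norm_taylorTerm_le (ht : 0 < t) (b v : Fin n → ℂ) {R : ℝ} (hR : 0 < R) (k : ℕ) :
    ‖(herm v b / t) ^ k / (k.factorial : ℂ)‖
      ≤ (R ^ k)⁻¹ * Real.exp (R * ‖b‖ / t * oneNorm v) := by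
  rw [norm_div, norm_pow, norm_div, Complex.norm_real, Real.norm_of_nonneg ht.le,
    RCLike.norm_natCast, inv_mul_eq_div, le_div_iff₀ (by positivity)]
  have hv := oneNorm_nonneg v
  calc (‖herm v b‖ / t) ^ k / k.factorial * R ^ k
      ≤ (‖b‖ * oneNorm v / t) ^ k / k.factorial * R ^ k := by
        gcongr; exact norm_herm_le_oneNorm_left v b
    _ = (R * ‖b‖ / t * oneNorm v) ^ k / k.factorial := by
        rw [div_mul_eq_mul_div, ← mul_pow]
        congr 2
        ring
    _ ≤ _ := Real.pow_div_factorial_le_exp _ (by positivity) k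

lemma differentiable_taylorTerm (t : ℝ) (b : Fin n → ℂ) (k : ℕ) :
    Differentiable ℂ fun v : Fin n → ℂ => (herm v b / t) ^ k / (k.factorial : ℂ) := by
  have h1 : Differentiable ℂ fun v : Fin n → ℂ => herm v b := by
    unfold herm; fun_prop
  simp only [div_eq_mul_inv]
  exact ((h1.mul_const _).pow k).mul_const _

lemma memLp_taylorTerm (ht : 0 < t) (hp : 1 ≤ p) (hp' : p ≠ ∞) (b : Fin n → ℂ) (k : ℕ) :
    MemLp (fun v : Fin n → ℂ => (herm v b / t) ^ k / (k.factorial : ℂ)) p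
      (gauss n (2 * t / p.toReal)) :=
  (memLp_exp_oneNorm ht hp hp' (1 * ‖b‖ / t)).of_le_mul (c := ((1 : ℝ) ^ k)⁻¹)
    (differentiable_taylorTerm t b k).continuous.aestronglyMeasurable
    (.of_forall fun v => by
      rw [Complex.norm_real, Real.norm_of_nonneg (Real.exp_pos _).le]
      exact norm_taylorTerm_le ht b v one_pos k)

section Injectivity

variable [ht : Fact (0 < t)] [hp : Fact (1 ≤ p)] [hp' : Fact (p ≠ ∞)]

/-- Converts pointwise bounds of exponential type into norm bounds; `N` is the norm of the majorant,
finite because the Gaussian weight dominates it. -/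
lemma exists_norm_le_of_ev_le (n : ℕ) (t : ℝ) (p : ℝ≥0∞) [ht : Fact (0 < t)] [hp : Fact (1 ≤ p)]
    [hp' : Fact (p ≠ ∞)] (M : ℝ) : ∃ N : ℝ, 0 ≤ N ∧ ∀ (c : ℝ) (d : FockSpace n t p), 0 ≤ c →
      (∀ z, ‖ev t p z d‖ ≤ c * Real.exp (M * oneNorm z)) → ‖d‖ ≤ c * N := by
  have hm := memLp_exp_oneNorm (n := n) ht.out hp.out hp'.out M
  refine ⟨(eLpNorm (fun w : Fin n → ℂ => (Real.exp (M * oneNorm w) : ℂ)) p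
    (gauss n (2 * t / p.toReal))).toReal, ENNReal.toReal_nonneg, fun c d hc h => ?_⟩
  rw [norm_eq_eLpNorm_ev]
  have := eLpNorm_le_mul_eLpNorm_of_ae_le_mul (μ := gauss n (2 * t / p.toReal))
    (f := fun z => ev t p z d) (g := fun w : Fin n → ℂ => (Real.exp (M * oneNorm w) : ℂ)) (c := c)
    (.of_forall fun z => by
      rw [Complex.norm_real, Real.norm_of_nonneg (Real.exp_pos _).le]
      exact h z) p
  refine (ENNReal.toReal_mono (ENNReal.mul_ne_top ENNReal.ofReal_ne_top hm.2.ne) this).trans_eq ?_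
  rw [ENNReal.toReal_mul, ENNReal.toReal_ofReal hc]

/-- The reproducing kernel `K_w`. -/
def kernel (t : ℝ) (p : ℝ≥0∞) [ht : Fact (0 < t)] [hp : Fact (1 ≤ p)] [hp' : Fact (p ≠ ∞)]
    (w : Fin n → ℂ) : FockSpace n t p :=
  cexp (sqNorm w / (2 * t)) • normKernel t p w

lemma ev_kernel (z w : Fin n → ℂ) : ev t p z (kernel t p w) = cexp (herm z w / t) := by
  rw [kernel, map_smul, ev_normKernel, normKernelFun, smul_eq_mul, ← Complex.exp_add]
  congr 1
  ring

lemma continuous_kernel : Continuous (kernel (n := n) t p) := by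
  have ht0 := ht.out
  rw [continuous_iff_continuousAt]
  intro w
  -- `‖w‖` accounts for the kernel at `w`; of the remaining `3`, two units come from the exponential
  -- in `norm_cexp_sub_cexp_le` and one from absorbing a linear factor.
  obtain ⟨N, hN, h⟩ := exists_norm_le_of_ev_le n t p ((‖w‖ + 3) / t)
  have key : ∀ w', ‖w' - w‖ ≤ 1 → ‖kernel t p w' - kernel t p w‖ ≤ ‖w' - w‖ * N := by
    intro w' hw'
    refine h _ _ (norm_nonneg _) fun z => ?_
    have hz := oneNorm_nonneg z
    rw [map_sub, ev_kernel, ev_kernel]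
    refine (norm_cexp_sub_cexp_le _ _).trans ?_
    have nd : ∀ a : ℂ, ‖a / t‖ = ‖a‖ / t := fun a => by
      rw [norm_div, Complex.norm_real, Real.norm_of_nonneg ht0.le]
    have e : herm z w' / t - herm z w / t = herm z (w' - w) / (t : ℂ) := by
      rw [sub_eq_add_neg w', herm_add_right, herm_neg_right]; ring
    have e1 : ‖herm z w / t‖ ≤ ‖w‖ / t * oneNorm z := by
      rw [nd, div_mul_eq_mul_div]; gcongr; exact norm_herm_le_oneNorm_left z w
    have e2 : ‖herm z w' / t - herm z w / t‖ ≤ ‖w' - w‖ * (1 / t * oneNorm z) := by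
      rw [e, nd]
      calc _ ≤ ‖w' - w‖ * oneNorm z / t := by
            gcongr; exact norm_herm_le_oneNorm_left z _
        _ = _ := by ring
    have e3 : ‖herm z w' / t - herm z w / t‖ ≤ 1 / t * oneNorm z :=
      e2.trans (mul_le_of_le_one_left (by positivity) hw')
    have e4 : 1 / t * oneNorm z ≤ Real.exp (1 / t * oneNorm z) := by
      linarith [Real.add_one_le_exp (1 / t * oneNorm z)]
    calc _ ≤ Real.exp (‖w‖ / t * oneNorm z) * Real.exp (2 * (1 / t * oneNorm z)) *
          (‖w' - w‖ * Real.exp (1 / t * oneNorm z)) := by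
          gcongr
          exact e2.trans (by gcongr)
      _ = ‖w' - w‖ * (Real.exp (‖w‖ / t * oneNorm z) * Real.exp (2 * (1 / t * oneNorm z)) *
          Real.exp (1 / t * oneNorm z)) := by ring
      _ = _ := by
          rw [← Real.exp_add, ← Real.exp_add]
          congr 2
          ring
  refine tendsto_iff_norm_sub_tendsto_zero.2 (squeeze_zero' (.of_forall fun _ => norm_nonneg _)
    (g := fun w' => ‖w' - w‖ * N) ?_ ?_)
  · filter_upwards [Metric.closedBall_mem_nhds w one_pos] with w' hw'
    exact key w' (by simpa [dist_eq_norm] using hw')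
  · have : Continuous fun w' => ‖w' - w‖ * N := by fun_prop
    simpa using this.tendsto w

lemma ev_fockProj (H : Lp ℂ p (gauss n (2 * t / p.toReal))) (z : Fin n → ℂ) :
    ev t p z (fockProj n t p H) = bargmann t H z := by
  have h : bargmann t (toLp (fockProj n t p H)) = bargmann t (bargmann t H) :=
    bargmann_congr (exponent_pos ht.out hp.out hp'.out) (coeFn_bargmannLp H)
  rw [ev_apply, h, bargmann_eq_self ht.out hp.out hp'.out
    (differentiable_bargmann ht.out hp.out hp'.out (Lp.memLp H))
    (memLp_bargmann ht.out hp.out hp'.out (Lp.memLp H))]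

lemma fockProj_toLp (g : FockSpace n t p) : fockProj n t p (toLp g) = g :=
  ext_ev fun z => by rw [ev_fockProj, ev_apply]

/-- The reproducing kernels span a dense subspace. -/
lemma eq_zero_of_kernel_eq_zero {B : FockSpace n t p →L[ℂ] FockSpace n t p}
    (hB : ∀ w, B (kernel t p w) = 0) : B = 0 := by
  have ht0 := ht.out
  have hs := exponent_pos ht0 hp.out hp'.out
  have := isProbabilityMeasure_gauss (n := n) ht0
  have := isProbabilityMeasure_gauss (n := n) hs
  have hzero : ∀ h : (Fin n → ℂ) → ℂ, Continuous h → HasCompactSupport h →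
      ∀ hm : MemLp h p (gauss n (2 * t / p.toReal)), B (fockProj n t p hm.toLp) = 0 := by
    intro h hc hs' hm
    have hk := continuous_kernel (n := n) (t := t) (p := p)
    have hint : Integrable (fun w => h w • kernel t p w) (gauss n t) :=
      Continuous.integrable_of_hasCompactSupport (hc.smul hk) hs'.smul_right
    -- For compactly supported `h` the projection is a Bochner integral of reproducing kernels, on
    -- which `B` vanishes. Such `h` are dense in `L^p`, and the projection fixes the Fock space.
    have e : fockProj n t p hm.toLp = ∫ w, h w • kernel t p w ∂(gauss n t) := by
      refine ext_ev fun z => ?_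
      rw [ev_fockProj, bargmann_congr hs hm.coeFn_toLp, ← (ev t p z).integral_comp_comm hint,
        bargmann]
      refine integral_congr_ae (.of_forall fun w => ?_)
      simp only [map_smul, ev_kernel, smul_eq_mul, mul_comm]
    rw [e, ← B.integral_comp_comm hint]
    simp [hB]
  ext1 g
  rw [zero_apply, ← norm_le_zero_iff]
  refine le_of_forall_pos_le_add fun ε hε => ?_
  set L := B ∘L fockProj n t p with hL
  obtain ⟨h, hs', hle, hc, hm⟩ := (Lp.memLp (toLp g)).exists_hasCompactSupport_eLpNorm_sub_le
    hp'.out (ε := ENNReal.ofReal (ε / (‖L‖ + 1))) (by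
      have : 0 < ε / (‖L‖ + 1) := by positivity
      simpa using this)
  have e1 : B g = L (toLp g - hm.toLp) := by
    rw [map_sub, hL, ContinuousLinearMap.comp_apply, ContinuousLinearMap.comp_apply,
      hzero h hc hs' hm, sub_zero, fockProj_toLp]
  have e2 : ‖toLp g - hm.toLp‖ ≤ ε / (‖L‖ + 1) := by
    rw [Lp.norm_def]
    refine ENNReal.toReal_le_of_le_ofReal (by positivity) ?_
    rw [eLpNorm_congr_ae ((Lp.coeFn_sub _ _).trans
      ((Filter.EventuallyEq.refl _ _).sub hm.coeFn_toLp))]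
    exact hle
  rw [e1, zero_add]
  calc _ ≤ ‖L‖ * (ε / (‖L‖ + 1)) := (L.le_opNorm _).trans (by gcongr)
    _ ≤ (‖L‖ + 1) * (ε / (‖L‖ + 1)) := by gcongr; linarith
    _ = ε := by field_simp

/-- The Taylor coefficients of the reproducing kernel along the line spanned by `b`. -/
def taylorTerm (t : ℝ) (p : ℝ≥0∞) [ht : Fact (0 < t)] [hp : Fact (1 ≤ p)] [hp' : Fact (p ≠ ∞)]
    (b : Fin n → ℂ) (k : ℕ) : FockSpace n t p :=
  ofEntire _ (differentiable_taylorTerm t b k) (memLp_taylorTerm ht.out hp.out hp'.out b k)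

lemma ev_taylorTerm (b v : Fin n → ℂ) (k : ℕ) :
    ev t p v (taylorTerm t p b k) = (herm v b / t) ^ k / (k.factorial : ℂ) :=
  ev_ofEntire _ _ _

lemma exists_norm_taylorTerm_le (t : ℝ) (p : ℝ≥0∞) [ht : Fact (0 < t)] [hp : Fact (1 ≤ p)]
    [hp' : Fact (p ≠ ∞)] (b : Fin n → ℂ) {R : ℝ} (hR : 0 < R) :
    ∃ N : ℝ, 0 ≤ N ∧ ∀ k, ‖taylorTerm t p b k‖ ≤ (R ^ k)⁻¹ * N := by
  obtain ⟨N, hN, h⟩ := exists_norm_le_of_ev_le n t p (R * ‖b‖ / t)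
  exact ⟨N, hN, fun k => h _ _ (by positivity) fun z => by
    rw [ev_taylorTerm]; exact norm_taylorTerm_le ht.out b z hR k⟩

/-- The kernel is antiholomorphic in its index, hence the conjugate on `μ`. Norm convergence of the
series makes `A K_w` a power series in the conjugate parameter for any bounded `A`. -/
lemma hasSum_taylorTerm (b : Fin n → ℂ) (μ : ℂ) :
    HasSum (fun k => μ ^ k • taylorTerm t p b k) (kernel t p (conj μ • b)) := by
  have hs : Summable fun k => μ ^ k • taylorTerm t p b k := by
    -- This radius leaves a geometric series of ratio `1/2`.
    obtain ⟨N, hN, h⟩ := exists_norm_taylorTerm_le t p b (R := 2 * (‖μ‖ + 1)) (by positivity)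
    refine Summable.of_norm_bounded (g := fun k => N * (1 / 2) ^ k)
      (summable_geometric_two.mul_left N) fun k => ?_
    rw [norm_smul, norm_pow]
    calc ‖μ‖ ^ k * ‖taylorTerm t p b k‖
        ≤ (‖μ‖ + 1) ^ k * (((2 * (‖μ‖ + 1)) ^ k)⁻¹ * N) := by
          gcongr
          · linarith
          · exact h k
      _ = _ := by
          rw [mul_pow, one_div, inv_pow]
          field_simp
  have : ∑' k, μ ^ k • taylorTerm t p b k = kernel t p (conj μ • b) := by
    refine ext_ev fun v => ?_
    rw [(ev t p v).map_tsum hs, ev_kernel]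
    have e : herm v (conj μ • b) / t = μ * (herm v b / t) := by
      simp only [herm, Pi.smul_apply, smul_eq_mul, map_mul, Complex.conj_conj, Finset.sum_div,
        Finset.mul_sum]
      exact Finset.sum_congr rfl fun i _ => by ring
    rw [e, Complex.exp_eq_exp_ℂ, NormedSpace.exp_eq_tsum_div]
    refine tsum_congr fun k => ?_
    rw [map_smul, ev_taylorTerm, smul_eq_mul, mul_pow, mul_div_assoc]
  exact this ▸ hs.hasSum

/-- Each term is entire in `s`, and the series has a summable majorant on the unit ball around any
`s₀`. -/
lemma differentiable_tsum_ev (A : FockSpace n t p →L[ℂ] FockSpace n t p) (b : Fin n → ℂ)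
    {α β : ℂ → ℂ} (hα : Differentiable ℂ α) (hβ : Differentiable ℂ β) :
    Differentiable ℂ fun s => ∑' k, β s ^ k * ev t p (α s • b) (A (taylorTerm t p b k)) := by
  have ht0 := ht.out
  intro s₀
  have hcomp := ProperSpace.isCompact_closedBall s₀ (1 : ℝ)
  obtain ⟨Rβ, hRβ⟩ := hcomp.exists_bound_of_continuousOn hβ.continuous.continuousOn
  have hc := continuous_sqNorm (n := n)
  have hac := hα.continuous
  obtain ⟨Rα, hRα⟩ := hcomp.exists_bound_of_continuousOn
    (f := fun s => Real.exp (sqNorm (α s • b) / (2 * t))) (Continuous.continuousOn (by fun_prop))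
  have hs₀ : s₀ ∈ Metric.closedBall s₀ (1 : ℝ) := Metric.mem_closedBall_self zero_le_one
  have hRβ0 : 0 ≤ Rβ := (norm_nonneg _).trans (hRβ s₀ hs₀)
  have hRα0 : 0 ≤ Rα := (norm_nonneg _).trans (hRα s₀ hs₀)
  obtain ⟨C, hC, hev⟩ := exists_norm_ev_le n t p
  obtain ⟨N, hN, h⟩ := exists_norm_taylorTerm_le t p b (R := 2 * (Rβ + 1)) (by positivity)
  refine (differentiableOn_tsum_of_summable_norm (u := fun k => C * ‖A‖ * N * Rα * (1 / 2) ^ k)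
    (summable_geometric_two.mul_left _) (fun k => ?_) (Metric.isOpen_ball (x := s₀) (ε := 1))
    fun k s hs => ?_).differentiableAt (Metric.ball_mem_nhds s₀ one_pos)
  · have h1 : Differentiable ℂ fun s => α s • b := hα.smul_const b
    exact ((hβ.pow k).mul ((differentiable_ev _).comp h1)).differentiableOn
  · have hs' := Metric.ball_subset_closedBall hs
    have e1 := hev (α s • b) (A (taylorTerm t p b k))
    rw [neg_div, Real.exp_neg, ← div_eq_mul_inv, div_le_iff₀ (Real.exp_pos _)] at e1
    have e2 := hRα s hs'
    rw [Real.norm_of_nonneg (Real.exp_pos _).le] at e2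
    rw [norm_mul, norm_pow]
    calc _ ≤ (Rβ + 1) ^ k * (C * (‖A‖ * (((2 * (Rβ + 1)) ^ k)⁻¹ * N)) * Rα) := by
          gcongr
          · linarith [hRβ s hs']
          · refine e1.trans ?_
            gcongr
            exact (A.le_opNorm _).trans (by gcongr; exact h k)
      _ = _ := by
          rw [mul_pow, one_div, inv_pow]
          field_simp

lemma ev_kernel_eq_berezin (A : FockSpace n t p →L[ℂ] FockSpace n t p) (z : Fin n → ℂ) :
    ev t p z (A (kernel t p z)) = cexp (sqNorm z / t) * berezin A z := by
  rw [berezin_eq, kernel, map_smul, map_smul, smul_eq_mul, ← mul_assoc, ← Complex.exp_add]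
  congr 2
  ring

/-- Polarization: `(l, m) ↦ (A K_{m̄ b})(l b)` is holomorphic in both variables and vanishes for `m
= l̄`, where it is the Berezin transform up to a factor. Hence it vanishes identically, in
particular at `l = 1`, `m = 0`. -/
lemma apply_normKernel_zero_eq_zero {A : FockSpace n t p →L[ℂ] FockSpace n t p}
    (hA : ∀ z, berezin A z = 0) : A (normKernel t p 0) = 0 := by
  refine ext_ev fun b => ?_
  -- With `l = x + iy` and `m = x - iy`, the antidiagonal `m = l̄` is the set of real `x, y`, so the
  -- one-variable identity theorem applies to `x` and then to `y`.
  set G : ℂ → ℂ → ℂ := fun x y => ∑' k, (x - I * y) ^ k *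
    ev t p ((x + I * y) • b) (A (taylorTerm t p b k)) with hG
  have hsum : ∀ l m : ℂ, ∑' k, m ^ k * ev t p (l • b) (A (taylorTerm t p b k))
      = ev t p (l • b) (A (kernel t p (conj m • b))) := by
    intro l m
    have := ((hasSum_taylorTerm (t := t) (p := p) b m).mapL (ev t p (l • b) ∘L A)).tsum_eq
    rw [ContinuousLinearMap.comp_apply] at this
    rw [← this]
    refine tsum_congr fun k => ?_
    rw [map_smul, ContinuousLinearMap.comp_apply, smul_eq_mul]
  have h1 : ∀ x y : ℝ, G x y = 0 := by
    intro x y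
    simp only [hG]
    rw [hsum]
    have : conj (x - I * y : ℂ) = x + I * y := by
      simp
    rw [this, ev_kernel_eq_berezin, hA, mul_zero]
  have h2 : ∀ (y : ℝ) (x : ℂ), G x y = 0 := fun y =>
    eq_zero_of_ofReal_eq_zero (differentiable_tsum_ev A b (by fun_prop) (by fun_prop))
      fun x => h1 x y
  have h3 : ∀ (x y : ℂ), G x y = 0 := fun x =>
    eq_zero_of_ofReal_eq_zero (differentiable_tsum_ev A b (by fun_prop) (by fun_prop))
      fun y => h2 y x
  -- These values give `m = 0` and `l = 1`.
  have h4 := h3 (1 / 2) (-I / 2)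
  simp only [hG] at h4
  rw [hsum] at h4
  have e1 : (1 / 2 - I * (-I / 2) : ℂ) = 0 := by
    linear_combination (1 / 2 : ℂ) * I_mul_I
  have e2 : (1 / 2 + I * (-I / 2) : ℂ) = 1 := by
    linear_combination (-1 / 2 : ℂ) * I_mul_I
  have e3 : kernel t p (0 : Fin n → ℂ) = normKernel t p 0 := by
    simp [kernel, sqNorm]
  rw [e1, e2, map_zero, zero_smul, one_smul, e3] at h4
  rw [h4, map_zero]

/-- The Berezin transform is injective. -/
lemma eq_zero_of_berezin_eq_zero {A : FockSpace n t p →L[ℂ] FockSpace n t p}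
    (hA : ∀ z, berezin A z = 0) : A = 0 := by
  refine eq_zero_of_kernel_eq_zero fun w => ?_
  -- Shifting by `-w` moves the kernel at `w` to the kernel at `0`.
  have h := apply_normKernel_zero_eq_zero (A := shift (-w) A) fun z => by rw [berezin_shift, hA]
  rw [shift_apply, neg_neg, weyl_normKernel_zero] at h
  have h2 := weyl_neg_apply w (A (normKernel t p w))
  rw [h, map_zero] at h2
  rw [kernel, map_smul, ← h2, smul_zero]

lemma eq_of_berezin_eq {A B : FockSpace n t p →L[ℂ] FockSpace n t p}
    (h : ∀ z, berezin A z = berezin B z) : A = B := by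
  refine sub_eq_zero.1 (eq_zero_of_berezin_eq_zero fun z => ?_)
  rw [← berezinCLM_apply, map_sub, berezinCLM_apply, berezinCLM_apply, h, sub_self]

end Injectivity

/-! ### Translates of symbols and their Gaussian averages. -/

lemma norm_translate_le (z : Fin n → ℂ) (f : (Fin n → ℂ) →ᵇ ℂ) : ‖translate z f‖ ≤ ‖f‖ :=
  (BoundedContinuousFunction.norm_le (norm_nonneg f)).2 fun w => f.norm_coe_le_norm (w - z)

lemma translate_add (w z : Fin n → ℂ) (f : (Fin n → ℂ) →ᵇ ℂ) :
    translate (w + z) f = translate z (translate w f) := by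
  ext x
  change f (x - (w + z)) = f (x - z - w)
  congr 1
  abel

lemma translate_zero (f : (Fin n → ℂ) →ᵇ ℂ) : translate 0 f = f := by
  ext x
  change f (x - 0) = f x
  rw [sub_zero]

lemma continuous_translate {f : (Fin n → ℂ) →ᵇ ℂ} (hf : f ∈ BUC n) :
    Continuous fun z => translate z f := by
  have hf' : UniformContinuous f := hf
  rw [Metric.continuous_iff]
  intro z ε hε
  obtain ⟨δ, hδ, h⟩ := Metric.uniformContinuous_iff.1 hf' (ε / 2) (half_pos hε)
  refine ⟨δ, hδ, fun z' hz' => lt_of_le_of_lt ?_ (half_lt_self hε)⟩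
  refine (BoundedContinuousFunction.dist_le (half_pos hε).le).2 fun x => (h ?_).le
  change dist (x - z') (x - z) < δ
  rwa [dist_sub_left]

lemma star_mem_BUC {f : (Fin n → ℂ) →ᵇ ℂ} (hf : f ∈ BUC n) : star f ∈ BUC n := by
  have hf' : UniformContinuous f := hf
  exact Complex.isometry_conj.uniformContinuous.comp hf'

lemma integrable_bcf (ht : 0 < t) (f : (Fin n → ℂ) →ᵇ ℂ) (z : Fin n → ℂ) :
    Integrable (fun u => f (z - u)) (gauss n t) := by
  have := isProbabilityMeasure_gauss (n := n) ht
  exact .of_bound (Continuous.aestronglyMeasurable (by fun_prop)) ‖f‖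
    (.of_forall fun u => f.norm_coe_le_norm _)

lemma integral_translate_apply (ht : 0 < t) {f : (Fin n → ℂ) →ᵇ ℂ} (hf : f ∈ BUC n)
    (x : Fin n → ℂ) :
    (∫ u, translate u f ∂(gauss n t)) x = ∫ u, f (x - u) ∂(gauss n t) := by
  have := isProbabilityMeasure_gauss (n := n) ht
  have hint : Integrable (fun u => translate u f) (gauss n t) :=
    .of_bound (continuous_translate hf).aestronglyMeasurable ‖f‖
      (.of_forall fun u => norm_translate_le u f)
  exact ((BoundedContinuousFunction.evalCLM ℂ x).integral_comp_comm hint).symm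

/-- A closed convex set contains the mean, under a probability measure, of an integrable map into
it. Uniform continuity of `f` makes the average a Bochner integral in the supremum norm. -/
lemma integral_translate_mem {D₀ : Submodule ℂ ((Fin n → ℂ) →ᵇ ℂ)} (ht : 0 < t)
    (hBUC : D₀ ≤ BUC n)
    (hclosed : IsClosed (D₀ : Set ((Fin n → ℂ) →ᵇ ℂ)))
    (hinv : TranslationInvariant (D₀ : Set ((Fin n → ℂ) →ᵇ ℂ)))
    {f : (Fin n → ℂ) →ᵇ ℂ} (hf : f ∈ D₀) : ∫ u, translate u f ∂(gauss n t) ∈ D₀ := by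
  have := isProbabilityMeasure_gauss (n := n) ht
  have hint : Integrable (fun u => translate u f) (gauss n t) :=
    .of_bound (continuous_translate (hBUC hf)).aestronglyMeasurable ‖f‖
      (.of_forall fun u => norm_translate_le u f)
  exact (D₀.restrictScalars ℝ).convex.integral_mem hclosed (.of_forall fun u => hinv u f hf) hint

/-- Nonemptiness of the list matters: `(∗)` covers only products of at least one factor. -/
lemma exists_list_of_mem_closure {R : Type*} [Monoid R] {s : Set R} {x : R}
    (hx : x ∈ Subsemigroup.closure s) : ∃ l : List R, l ≠ [] ∧ (∀ y ∈ l, y ∈ s) ∧ l.prod = x := by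
  induction hx using Subsemigroup.closure_induction with
  | mem x hx => exact ⟨[x], by simp, by simpa using hx, by simp⟩
  | mul x y _ _ hx hy =>
    obtain ⟨l, hl, hls, rfl⟩ := hx
    obtain ⟨m, hm, hms, rfl⟩ := hy
    refine ⟨l ++ m, by simp [hl], fun y hy => ?_, by simp⟩
    rcases List.mem_append.1 hy with h | h
    exacts [hls y h, hms y h]

/-! ### The correspondence between symbol spaces and operator spaces. -/

section Correspondence

variable [ht : Fact (0 < t)] [hp : Fact (1 ≤ p)] [hp' : Fact (p ≠ ∞)]

lemma toeplitz_sub (f g : (Fin n → ℂ) →ᵇ ℂ) :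
    toeplitz t p (f - g) = toeplitz t p f - toeplitz t p g := by
  refine eq_of_berezin_eq fun z => ?_
  rw [← berezinCLM_apply z (_ - _), map_sub, berezinCLM_apply, berezinCLM_apply, berezin_toeplitz,
    berezin_toeplitz, berezin_toeplitz,
    ← integral_sub (integrable_bcf ht.out f z) (integrable_bcf ht.out g z)]
  rfl

lemma norm_toeplitz_le (f : (Fin n → ℂ) →ᵇ ℂ) :
    ‖toeplitz t p f‖ ≤ ‖fockProj n t p‖ * ‖f‖ := by
  refine ContinuousLinearMap.opNorm_le_bound _ (by positivity) fun g => ?_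
  have h1 : ‖mulSymbol p (gauss n (2 * t / p.toReal)) f (toLp g)‖ ≤ ‖f‖ * ‖g‖ :=
    (mulSymbol p _ f).le_of_opNorm_le (LinearMap.mkContinuous_norm_le _ (norm_nonneg f) _) (toLp g)
  rw [mul_assoc]
  exact ((fockProj n t p).le_opNorm _).trans (mul_le_mul_of_nonneg_left h1 (norm_nonneg _))

lemma continuous_toeplitz : Continuous (toeplitz (n := n) t p) := by
  refine (LipschitzWith.of_dist_le_mul (K := ‖fockProj n t p‖₊) fun f g => ?_).continuous
  rw [dist_eq_norm, dist_eq_norm, ← toeplitz_sub]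
  exact norm_toeplitz_le _

lemma continuous_shift_toeplitz {f : (Fin n → ℂ) →ᵇ ℂ} (hf : f ∈ BUC n) :
    Continuous fun u => shift u (toeplitz t p f) := by
  simp_rw [shift_toeplitz]
  exact continuous_toeplitz.comp (continuous_translate hf)

/-- Shifts are multiplicative, so norm continuity of orbits passes from the factors to the product.
-/
lemma continuous_shift_list_prod :
    ∀ l : List (FockSpace n t p →L[ℂ] FockSpace n t p),
      (∀ A ∈ l, Continuous fun u => shift u A) → Continuous fun u => shift u l.prod
  | [], _ => by simp only [List.prod_nil, shift_one]; exact continuous_const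
  | A :: l, h => by
    simp only [List.prod_cons, shift_mul]
    exact (h A (by simp)).mul
      (continuous_shift_list_prod l fun B hB => h B (List.mem_cons_of_mem A hB))

/-- Reading the identity off the Berezin transform avoids the phases in the composition law of Weyl
operators. -/
lemma shift_add (w z : Fin n → ℂ) (A : FockSpace n t p →L[ℂ] FockSpace n t p) :
    shift (w + z) A = shift z (shift w A) :=
  eq_of_berezin_eq fun x => by
    rw [berezin_shift, berezin_shift, berezin_shift]
    congr 1
    abel

lemma shift_zero (A : FockSpace n t p →L[ℂ] FockSpace n t p) : shift 0 A = A :=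
  eq_of_berezin_eq fun x => by rw [berezin_shift, sub_zero]

/-- The Gaussian average of the shifts of an operator is the Toeplitz operator whose symbol is the
Berezin transform. -/
lemma integral_shift_eq_toeplitz {A : FockSpace n t p →L[ℂ] FockSpace n t p}
    (hA : Continuous fun u => shift u A) {g : (Fin n → ℂ) →ᵇ ℂ} (hg : ∀ z, berezin A z = g z) :
    ∫ u, shift u A ∂(gauss n t) = toeplitz t p g := by
  have := isProbabilityMeasure_gauss (n := n) ht.out
  have hint : Integrable (fun u => shift u A) (gauss n t) :=
    .of_bound hA.aestronglyMeasurable ‖A‖ (.of_forall fun u => norm_shift_le u A)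
  refine eq_of_berezin_eq fun z => ?_
  rw [← berezinCLM_apply, ← (berezinCLM t p z).integral_comp_comm hint, berezin_toeplitz]
  refine integral_congr_ae (.of_forall fun u => ?_)
  simp only [berezinCLM_apply, berezin_shift, hg]

variable {D₀ : Submodule ℂ ((Fin n → ℂ) →ᵇ ℂ)}

lemma toeplitz_mem_toeplitzLin {f : (Fin n → ℂ) →ᵇ ℂ} (hf : f ∈ D₀) :
    toeplitz t p f ∈ toeplitzLin t p (D₀ : Set ((Fin n → ℂ) →ᵇ ℂ)) :=
  Submodule.le_topologicalClosure _ (Submodule.subset_span ⟨f, hf, rfl⟩)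

/-- An operator with norm continuous shifts lies in the closed span of the Toeplitz operators with
symbols in `D₀` if its Berezin transform lies in `D₀`. -/
lemma mem_toeplitzLin_of_berezin_mem
    (hinv : TranslationInvariant (D₀ : Set ((Fin n → ℂ) →ᵇ ℂ)))
    {A : FockSpace n t p →L[ℂ] FockSpace n t p} (hA : Continuous fun u => shift u A)
    {g : (Fin n → ℂ) →ᵇ ℂ} (hg : g ∈ D₀) (hAg : ∀ z, berezin A z = g z) :
    A ∈ toeplitzLin t p (D₀ : Set ((Fin n → ℂ) →ᵇ ℂ)) := by
  have h := mem_of_gauss_average_mem ht.out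
    (N := toeplitzLin t p (D₀ : Set ((Fin n → ℂ) →ᵇ ℂ)))
    (Submodule.isClosed_topologicalClosure _) hA (fun u => norm_shift_le u A) fun w => by
      have hw : Continuous fun u => shift u (shift w A) := by
        simp_rw [← shift_add]
        exact hA.comp (by fun_prop)
      simp_rw [shift_add]
      -- The average of the orbit around `w` is the Toeplitz operator of the translated transform,
      -- whose symbol stays in `D₀` by invariance.
      rw [integral_shift_eq_toeplitz hw (g := translate w g)
        fun z => by rw [berezin_shift, hAg]; rfl]
      exact toeplitz_mem_toeplitzLin (hinv w g hg)
  rwa [shift_zero] at h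

/-- The Berezin transform of an operator in the closed span of the Toeplitz operators with symbols
in `D₀` lies in `D₀`. -/
lemma berezin_mem_of_mem_toeplitzLin (hBUC : D₀ ≤ BUC n)
    (hclosed : IsClosed (D₀ : Set ((Fin n → ℂ) →ᵇ ℂ)))
    (hinv : TranslationInvariant (D₀ : Set ((Fin n → ℂ) →ᵇ ℂ)))
    {A : FockSpace n t p →L[ℂ] FockSpace n t p}
    (hA : A ∈ toeplitzLin t p (D₀ : Set ((Fin n → ℂ) →ᵇ ℂ))) :
    ∃ g ∈ D₀, ∀ z, berezin A z = g z := by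
  simp_rw [← berezinCLM_apply]
  let S : Submodule ℂ (FockSpace n t p →L[ℂ] FockSpace n t p) :=
    { carrier := {A | ∃ g ∈ D₀, ∀ z, berezinCLM t p z A = g z}
      zero_mem' := ⟨0, D₀.zero_mem, fun z => by simp⟩
      add_mem' := by
        rintro A B ⟨f, hf, hAf⟩ ⟨g, hg, hBg⟩
        exact ⟨f + g, D₀.add_mem hf hg, fun z => by rw [map_add, hAf, hBg]; rfl⟩
      smul_mem' := by
        rintro c A ⟨f, hf, hAf⟩
        exact ⟨c • f, D₀.smul_mem c hf, fun z => by rw [map_smul, hAf]; rfl⟩ }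
  have hspan : Submodule.span ℂ (toeplitz t p '' (D₀ : Set ((Fin n → ℂ) →ᵇ ℂ))) ≤ S := by
    rw [Submodule.span_le]
    rintro _ ⟨f, hf, rfl⟩
    exact ⟨_, integral_translate_mem ht.out hBUC hclosed hinv hf, fun z => by
      rw [berezinCLM_apply, berezin_toeplitz, integral_translate_apply ht.out (hBUC hf)]⟩
  -- By `exists_norm_berezin_le` the transforms of a norm convergent sequence are Cauchy in the
  -- supremum norm; their limit stays in the closed space `D₀`.
  have hS : IsClosed (S : Set (FockSpace n t p →L[ℂ] FockSpace n t p)) := by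
    obtain ⟨C, hC, hb⟩ := exists_norm_berezin_le n t p
    refine isSeqClosed_iff_isClosed.1 fun a A ha hlim => ?_
    choose g hg hag using ha
    have hcauchy : CauchySeq g := by
      rw [cauchySeq_iff_tendsto_dist_atTop_0]
      refine squeeze_zero (fun _ => dist_nonneg) (g := fun k => C * dist (a k.1) (a k.2))
        (fun k => ?_) ?_
      · refine (BoundedContinuousFunction.dist_le (by positivity)).2 fun z => ?_
        rw [← hag, ← hag, dist_eq_norm, dist_eq_norm, ← map_sub, berezinCLM_apply]
        exact hb _ z
      · simpa using (cauchySeq_iff_tendsto_dist_atTop_0.1 hlim.cauchySeq).const_mul C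
    obtain ⟨g₀, hg₀⟩ := cauchySeq_tendsto_of_complete hcauchy
    refine ⟨g₀, hclosed.mem_of_tendsto hg₀ (.of_forall hg), fun z => ?_⟩
    refine tendsto_nhds_unique (((berezinCLM t p z).continuous.tendsto A).comp hlim) ?_
    have := ((BoundedContinuousFunction.evalCLM ℂ z).continuous.tendsto g₀).comp hg₀
    refine this.congr fun k => ?_
    exact (hag k z).symm
  exact Submodule.topologicalClosure_minimal _ hspan hS hA

lemma prod_toeplitz_mem_adjoin {S : Set ((Fin n → ℂ) →ᵇ ℂ)} :
    ∀ k : ℕ, ∀ f : Fin (k + 1) → ((Fin n → ℂ) →ᵇ ℂ), (∀ i, f i ∈ S) →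
      (List.ofFn fun i => toeplitz t p (f i)).prod
        ∈ NonUnitalAlgebra.adjoin ℂ (toeplitz t p '' S)
  | 0, f, hf => by
    simpa using NonUnitalAlgebra.subset_adjoin ℂ (Set.mem_image_of_mem (toeplitz t p) (hf 0))
  | k + 1, f, hf => by
    rw [List.ofFn_succ, List.prod_cons]
    exact mul_mem (NonUnitalAlgebra.subset_adjoin ℂ (Set.mem_image_of_mem _ (hf 0)))
      (prod_toeplitz_mem_adjoin k (fun i => f i.succ) fun i => hf _)

lemma toeplitzLin_subset_toeplitzAlg (S : Set ((Fin n → ℂ) →ᵇ ℂ)) :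
    (toeplitzLin t p S : Set (FockSpace n t p →L[ℂ] FockSpace n t p)) ⊆ toeplitzAlg t p S :=
  closure_mono (Submodule.span_le (p := (NonUnitalAlgebra.adjoin ℂ
    (toeplitz t p '' S)).toSubmodule).2 (NonUnitalAlgebra.subset_adjoin ℂ))

/-- The generated algebra is spanned by finite products, and each product has a norm continuous
orbit and, by `(∗)`, a transform in `D₀`. -/
lemma toeplitzAlg_subset_toeplitzLin (hBUC : D₀ ≤ BUC n)
    (hinv : TranslationInvariant (D₀ : Set ((Fin n → ℂ) →ᵇ ℂ)))
    (h : ClosedUnderProductMaps t p (D₀ : Set ((Fin n → ℂ) →ᵇ ℂ))) :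
    (toeplitzAlg t p (D₀ : Set ((Fin n → ℂ) →ᵇ ℂ)) :
      Set (FockSpace n t p →L[ℂ] FockSpace n t p))
      ⊆ toeplitzLin t p (D₀ : Set ((Fin n → ℂ) →ᵇ ℂ)) := by
  refine closure_minimal ?_ (Submodule.isClosed_topologicalClosure _)
  intro A hA
  have hA' : A ∈ (NonUnitalAlgebra.adjoin ℂ
    (toeplitz t p '' (D₀ : Set ((Fin n → ℂ) →ᵇ ℂ)))).toSubmodule := hA
  rw [NonUnitalAlgebra.adjoin_eq_span] at hA'
  refine Submodule.span_le.2 (fun B hB => ?_) hA'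
  obtain ⟨l, hl, hls, rfl⟩ := exists_list_of_mem_closure hB
  have hls' : ∀ i : Fin l.length, ∃ f ∈ D₀, toeplitz t p f = l.get i :=
    fun i => hls _ (l.get_mem i)
  choose f hf hfl using hls'
  have hprod : (List.ofFn fun i => toeplitz t p (f i)).prod = l.prod := by
    simp only [hfl, List.ofFn_get]
  obtain ⟨g, hg, hgz⟩ := h l.length (List.length_pos_iff.2 hl) f hf
  rw [hprod] at hgz
  refine mem_toeplitzLin_of_berezin_mem hinv (continuous_shift_list_prod l fun A hA => ?_) hg hgz
  obtain ⟨f, hf, rfl⟩ := hls A hA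
  exact continuous_shift_toeplitz (hBUC hf)

/-- The hypothesis concerns only the algebraic span of products, which lies in both the Banach
algebra and the `C*`-algebra, so it serves both parts of the theorem. -/
lemma closedUnderProductMaps_of_subset (hBUC : D₀ ≤ BUC n)
    (hclosed : IsClosed (D₀ : Set ((Fin n → ℂ) →ᵇ ℂ)))
    (hinv : TranslationInvariant (D₀ : Set ((Fin n → ℂ) →ᵇ ℂ)))
    (h : (NonUnitalAlgebra.adjoin ℂ (toeplitz t p '' (D₀ : Set ((Fin n → ℂ) →ᵇ ℂ))) :
      Set (FockSpace n t p →L[ℂ] FockSpace n t p))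
      ⊆ toeplitzLin t p (D₀ : Set ((Fin n → ℂ) →ᵇ ℂ))) :
    ClosedUnderProductMaps t p (D₀ : Set ((Fin n → ℂ) →ᵇ ℂ)) := by
  intro k hk f hf
  obtain ⟨k, rfl⟩ := Nat.exists_eq_succ_of_ne_zero (by omega : k ≠ 0)
  exact berezin_mem_of_mem_toeplitzLin hBUC hclosed hinv (h (prod_toeplitz_mem_adjoin k f hf))

end Correspondence

/-! ### Adjoints and complex conjugation for `p = 2`. -/

section Hilbert

variable [ht : Fact (0 < t)]

lemma berezin_eq_inner (A : FockSpace n t 2 →L[ℂ] FockSpace n t 2) (z : Fin n → ℂ) :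
    berezin A z = inner ℂ (normKernel t 2 z) (A (normKernel t 2 z)) := by
  have e : gauss n (2 * t / (2 : ℝ≥0∞).toReal) = gauss n t := by simp
  change _ = inner ℂ (toLp (normKernel t 2 z)) (toLp (A (normKernel t 2 z)))
  have hk : toLp (normKernel t 2 z) =ᵐ[gauss n (2 * t / (2 : ℝ≥0∞).toReal)] normKernelFun t z :=
    MemLp.coeFn_toLp (memLp_normKernelFun ht.out Fact.out Fact.out z)
  rw [MeasureTheory.L2.inner_def, berezin]
  -- The Gaussian measure in the Berezin integral is rewritten in the form `2t / 2` carried by the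
  -- type of the Fock space.
  conv_lhs => rw [← e]
  refine integral_congr_ae ?_
  filter_upwards [hk] with w hw
  rw [hw, RCLike.inner_apply]

/-- The transform of an adjoint is the conjugate transform, so both sides have the same Gaussian
average as transform. -/
lemma star_toeplitz (f : (Fin n → ℂ) →ᵇ ℂ) : star (toeplitz t 2 f) = toeplitz t 2 (star f) := by
  refine eq_of_berezin_eq fun z => ?_
  rw [berezin_eq_inner, ContinuousLinearMap.star_eq_adjoint,
    ContinuousLinearMap.adjoint_inner_right, ← inner_conj_symm, ← berezin_eq_inner,
    berezin_toeplitz, berezin_toeplitz, ← integral_conj]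
  rfl

variable {D₀ : Submodule ℂ ((Fin n → ℂ) →ᵇ ℂ)}

/-- The generators are already stable under adjoints, so adjoining the adjoints adds nothing, even
before taking closures. -/
lemma toeplitzStarAlg_eq_toeplitzAlg (hstar : ∀ f ∈ D₀, star f ∈ D₀) :
    (toeplitzStarAlg t (D₀ : Set ((Fin n → ℂ) →ᵇ ℂ)) :
      Set (FockSpace n t 2 →L[ℂ] FockSpace n t 2))
      = toeplitzAlg t 2 (D₀ : Set ((Fin n → ℂ) →ᵇ ℂ)) := by
  have h : star (toeplitz t 2 '' (D₀ : Set ((Fin n → ℂ) →ᵇ ℂ)))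
      ⊆ toeplitz t 2 '' (D₀ : Set ((Fin n → ℂ) →ᵇ ℂ)) := by
    rintro A ⟨f, hf, hfA⟩
    exact ⟨star f, hstar f hf, by rw [← star_toeplitz, hfA, star_star]⟩
  have h2 := NonUnitalStarAlgebra.adjoin_toNonUnitalSubalgebra ℂ
    (toeplitz t 2 '' (D₀ : Set ((Fin n → ℂ) →ᵇ ℂ)))
  rw [Set.union_eq_self_of_subset_right h] at h2
  change closure _ = closure _
  congr 1
  exact congrArg (fun B : NonUnitalSubalgebra ℂ (FockSpace n t 2 →L[ℂ] FockSpace n t 2) =>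
    (B : Set (FockSpace n t 2 →L[ℂ] FockSpace n t 2))) h2

lemma adjoin_subset_toeplitzStarAlg (S : Set ((Fin n → ℂ) →ᵇ ℂ)) :
    (NonUnitalAlgebra.adjoin ℂ (toeplitz t 2 '' S) :
      Set (FockSpace n t 2 →L[ℂ] FockSpace n t 2)) ⊆ toeplitzStarAlg t S := by
  refine Set.Subset.trans ?_ (subset_closure (s := (NonUnitalStarAlgebra.adjoin ℂ
    (toeplitz t 2 '' S) : Set (FockSpace n t 2 →L[ℂ] FockSpace n t 2))))
  exact NonUnitalAlgebra.adjoin_le (S := (NonUnitalStarAlgebra.adjoin ℂ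
    (toeplitz t 2 '' S)).toNonUnitalSubalgebra) (NonUnitalStarAlgebra.subset_adjoin ℂ _)

lemma translate_star (w : Fin n → ℂ) (f : (Fin n → ℂ) →ᵇ ℂ) :
    translate w (star f) = star (translate w f) := rfl

/-- The transform of `T_{f̄}` is the Gaussian average of `f̄`. Applied to all translates of `f`, the
hypothesis puts every such average in `D₀`, and `mem_of_gauss_average_mem` with `N = D₀` returns
`f̄`. -/
lemma star_mem_of_toeplitz_star_mem (hBUC : D₀ ≤ BUC n)
    (hclosed : IsClosed (D₀ : Set ((Fin n → ℂ) →ᵇ ℂ)))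
    (hinv : TranslationInvariant (D₀ : Set ((Fin n → ℂ) →ᵇ ℂ)))
    (h : ∀ f ∈ D₀, toeplitz t 2 (star f) ∈ toeplitzLin t 2 (D₀ : Set ((Fin n → ℂ) →ᵇ ℂ)))
    {f : (Fin n → ℂ) →ᵇ ℂ} (hf : f ∈ D₀) : star f ∈ D₀ := by
  have hs := star_mem_BUC (hBUC hf)
  have hmem := mem_of_gauss_average_mem ht.out hclosed (continuous_translate hs)
    (fun z => norm_translate_le z (star f)) fun w => by
      obtain ⟨g, hg, hgz⟩ := berezin_mem_of_mem_toeplitzLin hBUC hclosed hinv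
        (h (translate w f) (hinv w f hf))
      have e : ∫ z, translate (w + z) (star f) ∂(gauss n t) = g := by
        simp_rw [translate_add, translate_star w]
        ext x
        rw [integral_translate_apply ht.out (star_mem_BUC (hBUC (hinv w f hf))), ← hgz,
          berezin_toeplitz]
      rw [e]
      exact hg
  rwa [translate_zero] at hmem

end Hilbert

end Fock

end

/-! ### The two equivalences. -/

theorem mainTheorem5 (n : ℕ) (t : ℝ) [Fact (0 < t)]
    (D₀ : Submodule ℂ ((Fin n → ℂ) →ᵇ ℂ))
    (hBUC : D₀ ≤ Fock.BUC n)
    (hclosed : IsClosed (D₀ : Set ((Fin n → ℂ) →ᵇ ℂ)))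
    (hinv : Fock.TranslationInvariant (D₀ : Set ((Fin n → ℂ) →ᵇ ℂ))) :
    (∀ (p : ℝ≥0∞) [Fact (1 ≤ p)] [Fact (p ≠ ∞)], 1 < p →
      ((Fock.toeplitzLin t p (D₀ : Set ((Fin n → ℂ) →ᵇ ℂ)) :
            Set (Fock.FockSpace n t p →L[ℂ] Fock.FockSpace n t p))
          = Fock.toeplitzAlg t p (D₀ : Set ((Fin n → ℂ) →ᵇ ℂ))
        ↔ Fock.ClosedUnderProductMaps t p
            (D₀ : Set ((Fin n → ℂ) →ᵇ ℂ)))) ∧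
    ((Fock.toeplitzLin t 2 (D₀ : Set ((Fin n → ℂ) →ᵇ ℂ)) :
          Set (Fock.FockSpace n t 2 →L[ℂ] Fock.FockSpace n t 2))
        = Fock.toeplitzStarAlg t (D₀ : Set ((Fin n → ℂ) →ᵇ ℂ))
      ↔ Fock.ClosedUnderProductMaps t 2
            (D₀ : Set ((Fin n → ℂ) →ᵇ ℂ)) ∧
          ∀ f ∈ D₀, star f ∈ D₀) := by
  refine ⟨fun p _ _ _ => ⟨fun h => ?_, fun h => ?_⟩, fun h => ⟨?_, ?_⟩, fun h => ?_⟩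
  · exact Fock.closedUnderProductMaps_of_subset hBUC hclosed hinv
      (h.symm ▸ subset_closure)
  · exact (Fock.toeplitzLin_subset_toeplitzAlg _).antisymm
      (Fock.toeplitzAlg_subset_toeplitzLin hBUC hinv h)
  · exact Fock.closedUnderProductMaps_of_subset hBUC hclosed hinv
      (h.symm ▸ Fock.adjoin_subset_toeplitzStarAlg _)
  · refine fun f hf => Fock.star_mem_of_toeplitz_star_mem (t := t) hBUC hclosed hinv
      (fun f hf => ?_) hf
    have h1 : Fock.toeplitz t 2 f ∈ Fock.toeplitzStarAlg t (D₀ : Set ((Fin n → ℂ) →ᵇ ℂ)) := by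
      have := Fock.toeplitz_mem_toeplitzLin (t := t) (p := 2) hf
      rwa [← SetLike.mem_coe, h] at this
    -- Only the equality of the closed span with a self-adjoint algebra is used to bring `T_{f̄}`
    -- back into the span.
    have h2 := star_mem h1
    rwa [Fock.star_toeplitz, ← SetLike.mem_coe, ← h] at h2
  · rw [Fock.toeplitzStarAlg_eq_toeplitzAlg h.2]
    exact (Fock.toeplitzLin_subset_toeplitzAlg _).antisymm
      (Fock.toeplitzAlg_subset_toeplitzLin hBUC hinv h.1)
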